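/- Let $H\in(0,1)$ and $K\in(0,1]$ satisfy $HK\le \tfrac34$, and let $B=(B_t)_{t\ge 0}$ be a bifractional Brownian motion with parameters $H,K$, i.e. a centered Gaussian process on a probability space $(\Omega,\mathcal F,P)$ with covariance $$E[B_sB_t]=\frac1{2^K}\Big(\big(t^{2H}+s^{2H}\big)^K-|t-s|^{2HK}\Big),\qquad s,t\ge 0.$$ For $n\ge 1$ put $$Z_n=\sum_{i=0}^{n-1}\Big[n^{2HK}\big(B_{(i+1)/n}-B_{i/n}\big)^2-E\big((B_{i+1}-B_i)^2\big)\Big],\qquad V_n=\frac{Z_n}{\sqrt{\operatorname{Var}(Z_n)}}.$$ Let $N\sim\mathcal N(0,1)$, and for real random variables $Y,Z$ let $d_{\mathrm{Kol}}(Y,Z)=\sup_{z\in\mathbb R}|P(Y\le z)-P(Z\le z)|$. Then $V_n$ converges in distribution to $N$ as $n\to\infty$. Moreover there is a constant $c_{H,K}$, depending only on $H$ and $K$, such that: - if $0<HK\le\tfrac12$, then $d_{\mathrm{Kol}}(V_n,N)\le c_{H,K}\,n^{-1/2}$ for every $n\ge1$; - if $\tfrac12\le HK<\tfrac34$, then $d_{\mathrm{Kol}}(V_n,N)\le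 c_{H,K}\,n^{2HK-3/2}$ for every $n\ge1$; - if $HK=\tfrac34$, then $d_{\mathrm{Kol}}(V_n,N)\le c_{H,K}/\sqrt{\log n}$ for every $n\ge2$. -/

import Mathlib

open MeasureTheory ProbabilityTheory Filter
open scoped NNReal

noncomputable section

/-- The covariance function
`R_{H,K}(s,t) = 2^{-K} ((t^{2H} + s^{2H})^K - |t - s|^{2HK})`. -/
def bifBmCov (H K : ℝ) (s t : ℝ≥0) : ℝ :=
  (1 / (2 : ℝ) ^ K) *
    (((t : ℝ) ^ (2 * H) + (s : ℝ) ^ (2 * H)) ^ K - |(t : ℝ) - (s : ℝ)| ^ (2 * H * K))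

/-- `B` is a bifractional Brownian motion with parameters `H`, `K` on `(Ω, P)`: a centered
Gaussian process indexed by `[0, ∞)` with covariance function `R_{H,K}`. -/
structure IsBifractionalBM {Ω : Type*} [MeasurableSpace Ω] (H K : ℝ)
    (B : ℝ≥0 → Ω → ℝ) (P : Measure Ω) : Prop where
  isGaussianProcess : IsGaussianProcess B P
  centered : ∀ t, ∫ ω, B t ω ∂P = 0
  covariance : ∀ s t, ∫ ω, B s ω * B t ω ∂P = bifBmCov H K s t

/-- The centered quadratic variation
`Z_n = ∑_{i=0}^{n-1} [n^{2HK} (B_{(i+1)/n} - B_{i/n})^2 - E((B_{i+1} - B_i)^2)]`. -/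
def quadVar {Ω : Type*} [MeasurableSpace Ω] (H K : ℝ)
    (B : ℝ≥0 → Ω → ℝ) (P : Measure Ω) (n : ℕ) (ω : Ω) : ℝ :=
  ∑ i ∈ Finset.range n,
    ((n : ℝ) ^ (2 * H * K) *
        (B (((i : ℝ≥0) + 1) / (n : ℝ≥0)) ω - B ((i : ℝ≥0) / (n : ℝ≥0)) ω) ^ 2
      - ∫ ω', (B ((i : ℝ≥0) + 1) ω' - B (i : ℝ≥0) ω') ^ 2 ∂P)

/-- The renormalized quadratic variation `V_n = Z_n / √Var(Z_n)`. -/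
def normQuadVar {Ω : Type*} [MeasurableSpace Ω] (H K : ℝ)
    (B : ℝ≥0 → Ω → ℝ) (P : Measure Ω) (n : ℕ) (ω : Ω) : ℝ :=
  quadVar H K B P n ω / √(variance (quadVar H K B P n) P)

/-- The Kolmogorov distance `sup_z |P(Y ≤ z) - Q(Z ≤ z)|` between the laws of two real random
variables, which may live on different probability spaces. -/
def kolmogorovDist {Ω Ω' : Type*} [MeasurableSpace Ω] [MeasurableSpace Ω']
    (Y : Ω → ℝ) (P : Measure Ω) (Z : Ω' → ℝ) (Q : Measure Ω') : ℝ :=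
  ⨆ z : ℝ, |P.real {ω | Y ω ≤ z} - Q.real {ω | Z ω ≤ z}|

end

/-!
Up to the rescaling of bifractional Brownian motion, `Z n = ∑ (X i ^ 2 - C i i)`, where `X` is the
centred Gaussian vector of the first `n` unit increments and `C` is its covariance matrix. Rotating
`X` into independent coordinates turns `Z n` into `∑ (Y i ^ 2 - v i)` with independent
`Y i ~ N(0, v i)`, where the `v i` are the eigenvalues of `C` (`exists_independent_rotation`).

For such sums Stein's method is elementary. If `f` is the Stein solution of a half-line and
`F = a * Z n` is normalised to have variance `1`, Gaussian integration by parts in each coordinate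
gives `E[F f(F)] = E[f'(F) ∑ 2 a² v i (Y i)²]`. Since `|f'| ≤ 2`, the Kolmogorov distance is
controlled by the standard deviation of `∑ 2 a² v i (Y i)²`, hence by `4 L / √(2 ∑ (C i j)²)`, where
`L` is any bound for the absolute row sums of `C`, which dominate its eigenvalues
(`abs_measureReal_sum_sq_sub_le`, `abs_measureReal_div_sqrt_variance_sub_le`).

It remains to estimate `2 ^ K * C i j = g i j + ρ i j`, where `g` (`powSumDiff`) is the mixed second
difference of `(s ^ (2H) + t ^ (2H)) ^ K` and `ρ` (`absPowDiff`) is stationary, the second difference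
of `|x| ^ (2HK)`. Concavity or convexity of powers fixes the signs of `g` and of `ρ` off the
diagonal, so absolute row sums telescope: they are bounded for `2HK ≤ 1` and of order
`n ^ (2HK - 1)` for `2HK ≥ 1`. Far from the origin the diagonal of `g + ρ` is at least `1`, so the
squared Frobenius norm is at least `n / 2`, which gives the rates for `HK < 3/4`. For `HK = 3/4` the
entries `ρ i j` are at least of order `|i - j| ^ (-1/2)`, which improves the lower bound to order
`n log n`, while `g` only contributes `O(n)` (`mul_log_le_sum_sq`).
-/

/-! ### The Stein equation for half-lines -/

/-- The distribution function of the standard Gaussian law. -/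
noncomputable def stdNormalCDF (x : ℝ) : ℝ := (gaussianReal 0 1).real (Set.Iic x)

/-- The density of the standard Gaussian law. -/
noncomputable def stdNormalPDF (x : ℝ) : ℝ := gaussianPDFReal 0 1 x

/-- The bounded solution of the Stein equation `f' x - x * f x = 1_{x ≤ z} - Φ z`. -/
noncomputable def steinSol (z x : ℝ) : ℝ :=
  (stdNormalCDF (min x z) - stdNormalCDF x * stdNormalCDF z) / stdNormalPDF x

/-- The derivative of `steinSol z` away from `z`, extended to `z` so that the Stein equation holds
everywhere. -/
noncomputable def steinDeriv (z x : ℝ) : ℝ :=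
  x * steinSol z x + (Set.indicator (Set.Iic z) 1 x - stdNormalCDF z)

lemma stdNormalPDF_eq (x : ℝ) : stdNormalPDF x = (√(2 * Real.pi))⁻¹ * Real.exp (-x ^ 2 / 2) := by
  simp [stdNormalPDF, gaussianPDFReal]

lemma stdNormalPDF_pos (x : ℝ) : 0 < stdNormalPDF x :=
  gaussianPDFReal_pos 0 1 x one_ne_zero

lemma hasDerivAt_stdNormalPDF (x : ℝ) : HasDerivAt stdNormalPDF (-x * stdNormalPDF x) x := by
  have h : HasDerivAt (fun x : ℝ => -x ^ 2 / 2) (-x) x :=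
    ((hasDerivAt_pow 2 x).neg.div_const 2).congr_deriv (by simp; ring)
  have := (h.exp).const_mul (√(2 * Real.pi))⁻¹
  rw [show stdNormalPDF = fun x : ℝ => (√(2 * Real.pi))⁻¹ * Real.exp (-x ^ 2 / 2) from
    funext stdNormalPDF_eq]
  exact this.congr_deriv (by ring)

lemma continuous_stdNormalPDF : Continuous stdNormalPDF :=
  continuous_iff_continuousAt.2 fun x => (hasDerivAt_stdNormalPDF x).continuousAt

lemma integrable_stdNormalPDF : Integrable stdNormalPDF := integrable_gaussianPDFReal 0 1

lemma stdNormalCDF_eq_integral (x : ℝ) : stdNormalCDF x = ∫ t in Set.Iic x, stdNormalPDF t := by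
  rw [stdNormalCDF, measureReal_def, gaussianReal_apply_eq_integral 0 one_ne_zero,
    ENNReal.toReal_ofReal]
  · rfl
  · exact setIntegral_nonneg measurableSet_Iic fun t _ => gaussianPDFReal_nonneg 0 1 t

lemma stdNormalCDF_nonneg (x : ℝ) : 0 ≤ stdNormalCDF x := measureReal_nonneg

lemma stdNormalCDF_le_one (x : ℝ) : stdNormalCDF x ≤ 1 := measureReal_le_one

lemma stdNormalCDF_mono : Monotone stdNormalCDF := fun _ _ h =>
  measureReal_mono (Set.Iic_subset_Iic.2 h)

lemma hasDerivAt_stdNormalCDF (x : ℝ) : HasDerivAt stdNormalCDF (stdNormalPDF x) x := by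
  have h : ∀ y, stdNormalCDF y = stdNormalCDF 0 + ∫ t in (0 : ℝ)..y, stdNormalPDF t := by
    intro y
    rw [stdNormalCDF_eq_integral, stdNormalCDF_eq_integral,
      ← intervalIntegral.integral_Iic_sub_Iic integrable_stdNormalPDF.integrableOn
        integrable_stdNormalPDF.integrableOn]
    ring
  rw [show stdNormalCDF = fun y => stdNormalCDF 0 + ∫ t in (0 : ℝ)..y, stdNormalPDF t from
    funext h]
  exact (intervalIntegral.integral_hasDerivAt_right
    (continuous_stdNormalPDF.intervalIntegrable _ _)
    (continuous_stdNormalPDF.stronglyMeasurableAtFilter _ _)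
    continuous_stdNormalPDF.continuousAt).const_add _

lemma continuous_stdNormalCDF : Continuous stdNormalCDF :=
  continuous_iff_continuousAt.2 fun x => (hasDerivAt_stdNormalCDF x).continuousAt

lemma stdNormalCDF_neg (x : ℝ) : stdNormalCDF (-x) = 1 - stdNormalCDF x := by
  have h1 : (gaussianReal 0 1).real (Set.Iic (-x)) = (gaussianReal 0 1).real (Set.Ici x) := by
    conv_lhs => rw [← neg_zero, ← gaussianReal_map_neg]
    rw [map_measureReal_apply measurable_neg measurableSet_Iic]
    congr 1
    ext y; simp
  have : NullSingletonClass (gaussianReal 0 1) := nullSingletonClass_gaussianReal one_ne_zero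
  rw [stdNormalCDF, h1, stdNormalCDF, ← measureReal_congr Ioi_ae_eq_Ici, ← Set.compl_Iic,
    probReal_compl_eq_one_sub measurableSet_Iic]

/-- The Mills ratio bound for the lower tail. -/
lemma neg_mul_stdNormalCDF_le (x : ℝ) : -x * stdNormalCDF x ≤ stdNormalPDF x := by
  have hd : ∀ t ∈ Set.Iic x, HasDerivAt stdNormalPDF (-t * stdNormalPDF t) t :=
    fun t _ => hasDerivAt_stdNormalPDF t
  have hint : Integrable (fun t : ℝ => -t * stdNormalPDF t) := by
    have := (integrable_mul_exp_neg_mul_sq (b := 1 / 2) (by norm_num)).const_mul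
      (-(√(2 * Real.pi))⁻¹)
    refine this.congr (ae_of_all _ fun t => ?_)
    simp only [stdNormalPDF_eq]
    rw [show -t ^ 2 / 2 = -(1 / 2) * t ^ 2 by ring]
    ring
  have hlim : Tendsto stdNormalPDF atBot (nhds 0) := by
    have h := tendsto_zero_of_hasDerivAt_of_integrableOn_Iic (a := 0)
      (fun t _ => hasDerivAt_stdNormalPDF t) hint.integrableOn
      integrable_stdNormalPDF.integrableOn
    exact h
  have key := integral_Iic_of_hasDerivAt_of_tendsto' hd hint.integrableOn hlim
  rw [sub_zero] at key
  rw [← key, stdNormalCDF_eq_integral, ← integral_const_mul]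
  refine setIntegral_mono_on (integrable_stdNormalPDF.integrableOn.const_mul _)
    hint.integrableOn measurableSet_Iic fun t ht => ?_
  have := stdNormalPDF_pos t
  have ht' : t ≤ x := ht
  nlinarith

lemma mul_one_sub_stdNormalCDF_le (x : ℝ) : x * (1 - stdNormalCDF x) ≤ stdNormalPDF x := by
  have := neg_mul_stdNormalCDF_le (-x)
  rw [stdNormalCDF_neg] at this
  simpa [stdNormalPDF_eq] using this

/-- The numerator of `steinSol` lies between `0` and `Φ x * (1 - Φ x)`. -/
lemma steinSol_mul_pdf_mem (z x : ℝ) :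
    0 ≤ steinSol z x * stdNormalPDF x ∧
      steinSol z x * stdNormalPDF x ≤ stdNormalCDF x * (1 - stdNormalCDF x) := by
  rw [steinSol, div_mul_cancel₀ _ (stdNormalPDF_pos x).ne']
  have hx0 := stdNormalCDF_nonneg x
  have hx1 := stdNormalCDF_le_one x
  have hz0 := stdNormalCDF_nonneg z
  have hz1 := stdNormalCDF_le_one z
  rcases le_total x z with h | h
  · have := stdNormalCDF_mono h
    rw [min_eq_left h]
    constructor <;> nlinarith
  · have := stdNormalCDF_mono h
    rw [min_eq_right h]
    constructor <;> nlinarith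

lemma steinSol_nonneg (z x : ℝ) : 0 ≤ steinSol z x :=
  nonneg_of_mul_nonneg_left (steinSol_mul_pdf_mem z x).1 (stdNormalPDF_pos x)

lemma abs_mul_steinSol_le (z x : ℝ) : |x * steinSol z x| ≤ 1 := by
  rw [abs_mul, abs_of_nonneg (steinSol_nonneg z x)]
  have h := (steinSol_mul_pdf_mem z x).2
  have hp := stdNormalPDF_pos x
  have hx0 := stdNormalCDF_nonneg x
  have hx1 := stdNormalCDF_le_one x
  refine le_of_mul_le_mul_right ?_ hp
  rw [one_mul, mul_assoc]
  refine (mul_le_mul_of_nonneg_left h (abs_nonneg x)).trans ?_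
  rcases abs_cases x with ⟨e, h0⟩ | ⟨e, h0⟩ <;> rw [e]
  · have := mul_one_sub_stdNormalCDF_le x
    have : 0 ≤ x * (1 - stdNormalCDF x) := mul_nonneg h0 (by linarith)
    nlinarith
  · have := neg_mul_stdNormalCDF_le x
    have : 0 ≤ -x * stdNormalCDF x := mul_nonneg (by linarith) hx0
    nlinarith

lemma abs_steinDeriv_le (z x : ℝ) : |steinDeriv z x| ≤ 2 := by
  have h1 := abs_mul_steinSol_le z x
  have hz0 := stdNormalCDF_nonneg z
  have hz1 := stdNormalCDF_le_one z
  have h2 : |Set.indicator (Set.Iic z) 1 x - stdNormalCDF z| ≤ 1 := by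
    by_cases hx : x ∈ Set.Iic z <;> simp only [hx, Set.indicator_of_mem, Set.indicator_of_notMem,
      Pi.one_apply, not_false_eq_true] <;> rw [abs_le] <;> constructor <;> linarith
  exact (abs_add_le _ _).trans (by linarith)

lemma continuous_steinSol (z : ℝ) : Continuous (steinSol z) := by
  refine Continuous.div ?_ continuous_stdNormalPDF fun x => (stdNormalPDF_pos x).ne'
  exact (continuous_stdNormalCDF.comp (continuous_id.min continuous_const)).sub
    (continuous_stdNormalCDF.mul continuous_const)

lemma abs_steinSol_le (z x : ℝ) : |steinSol z x| ≤ 1 + 1 / stdNormalPDF 1 := by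
  have h1 := abs_mul_steinSol_le z x
  have hp1 := stdNormalPDF_pos 1
  have hp := stdNormalPDF_pos x
  have hx0 := stdNormalCDF_nonneg x
  have hx1 := stdNormalCDF_le_one x
  have h0 := steinSol_nonneg z x
  rw [abs_mul, abs_of_nonneg h0] at h1
  rw [abs_of_nonneg h0]
  rcases le_total 1 |x| with hx | hx
  · have : 0 < 1 / stdNormalPDF 1 := by positivity
    nlinarith
  · have h2 := (steinSol_mul_pdf_mem z x).2
    have h3 : stdNormalPDF 1 ≤ stdNormalPDF x := by
      rw [stdNormalPDF_eq, stdNormalPDF_eq]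
      have : x ^ 2 ≤ 1 := by rw [← sq_abs]; nlinarith [abs_nonneg x]
      exact mul_le_mul_of_nonneg_left (Real.exp_le_exp.2 (by linarith)) (by positivity)
    have h4 : steinSol z x ≤ 1 / stdNormalPDF 1 := by
      rw [le_div_iff₀ hp1]
      nlinarith
    linarith

lemma measurable_steinDeriv (z : ℝ) : Measurable (steinDeriv z) := by
  refine (measurable_id.mul (continuous_steinSol z).measurable).add (Measurable.sub ?_
    measurable_const)
  exact measurable_one.indicator measurableSet_Iic

lemma hasDerivAt_steinSol {z x : ℝ} (hx : x ≠ z) :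
    HasDerivAt (steinSol z) (steinDeriv z x) x := by
  have hp := (stdNormalPDF_pos x).ne'
  have hnum : HasDerivAt (fun x => stdNormalCDF (min x z) - stdNormalCDF x * stdNormalCDF z)
      ((Set.indicator (Set.Iic z) 1 x - stdNormalCDF z) * stdNormalPDF x) x := by
    have hc := (hasDerivAt_stdNormalCDF x).mul_const (stdNormalCDF z)
    rcases lt_or_gt_of_ne hx with h | h
    · have : HasDerivAt (fun x => stdNormalCDF (min x z)) (stdNormalPDF x) x := by
        refine (hasDerivAt_stdNormalCDF x).congr_of_eventuallyEq ?_
        filter_upwards [Iio_mem_nhds h] with y hy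
        rw [min_eq_left (le_of_lt hy)]
      refine (this.sub hc).congr_deriv ?_
      rw [Set.indicator_of_mem (show x ∈ Set.Iic z from h.le), Pi.one_apply]
      ring
    · have : HasDerivAt (fun x => stdNormalCDF (min x z)) 0 x := by
        refine (hasDerivAt_const x (stdNormalCDF z)).congr_of_eventuallyEq ?_
        filter_upwards [Ioi_mem_nhds h] with y hy
        rw [min_eq_right (le_of_lt hy)]
      refine (this.sub hc).congr_deriv ?_
      rw [Set.indicator_of_notMem (show x ∉ Set.Iic z from not_le.2 h)]
      ring
  refine (hnum.div (hasDerivAt_stdNormalPDF x) hp).congr_deriv ?_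
  rw [steinDeriv, steinSol]
  field_simp
  ring

/-! ### Gaussian integration by parts -/

lemma integrable_gaussianReal_iff {m : ℝ} {v : ℝ≥0} (hv : v ≠ 0) {f : ℝ → ℝ} :
    Integrable f (gaussianReal m v) ↔ Integrable (fun x => gaussianPDFReal m v x * f x) := by
  rw [gaussianReal_of_var_ne_zero m hv, integrable_withDensity_iff_integrable_smul'
    (measurable_gaussianPDF m v) (ae_of_all _ fun _ => gaussianPDF_lt_top)]
  simp [toReal_gaussianPDF]

lemma tendsto_gaussianPDFReal_mul_of_le_pow_three {v : ℝ≥0} (hv : v ≠ 0) {g : ℝ → ℝ} {A : ℝ}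
    (hg : ∀ x, |g x| ≤ A * (1 + |x| ^ 3)) :
    Tendsto (fun x => gaussianPDFReal 0 v x * g x) (cocompact ℝ) (nhds 0) := by
  have hv' : (0 : ℝ) < v := by positivity
  have h : ∀ s : ℝ, Tendsto (fun x : ℝ => |x| ^ s * Real.exp (-(1 / (2 * v : ℝ)) * x ^ 2))
      (cocompact ℝ) (nhds 0) := tendsto_rpow_abs_mul_exp_neg_mul_sq_cocompact (by positivity)
  have h2 := (((h 0).add (h 3)).const_mul ((√(2 * Real.pi * v))⁻¹ * A))
  rw [add_zero, mul_zero] at h2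
  refine squeeze_zero_norm (fun x => ?_) h2
  rw [Real.norm_eq_abs, abs_mul, abs_of_nonneg (gaussianPDFReal_nonneg 0 v x), gaussianPDFReal,
    sub_zero, Real.rpow_zero, show (3 : ℝ) = ((3 : ℕ) : ℝ) by norm_num, Real.rpow_natCast,
    show -x ^ 2 / (2 * (v : ℝ)) = -(1 / (2 * v : ℝ)) * x ^ 2 by ring]
  calc _ ≤ (√(2 * Real.pi * v))⁻¹ * Real.exp (-(1 / (2 * v : ℝ)) * x ^ 2)
        * (A * (1 + |x| ^ 3)) := by gcongr; exact hg x
    _ = _ := by ring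

/-- Gaussian integration by parts for a continuous function that is differentiable off a countable
set, which allows for functions built from the kinked solutions of the Stein equation. -/
lemma integral_mul_gaussianReal_eq (v : ℝ≥0) {g g' : ℝ → ℝ} {s : Set ℝ} {A : ℝ}
    (hs : s.Countable) (hc : Continuous g) (hd : ∀ x, x ∉ s → HasDerivAt g (g' x) x)
    (hg : ∀ x, |g x| ≤ A * (1 + |x| ^ 3))
    (hi : Integrable (fun x => x * g x) (gaussianReal 0 v))
    (hi' : Integrable g' (gaussianReal 0 v)) :
    ∫ x, x * g x ∂gaussianReal 0 v = v * ∫ x, g' x ∂gaussianReal 0 v := by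
  rcases eq_or_ne v 0 with rfl | hv
  · simp [gaussianReal_zero_var]
  have hv' : (v : ℝ) ≠ 0 := by positivity
  rw [integrable_gaussianReal_iff hv] at hi hi'
  rw [integral_gaussianReal_eq_integral_smul hv, integral_gaussianReal_eq_integral_smul hv]
  simp only [smul_eq_mul]
  set p := gaussianPDFReal 0 v with hp
  have hpd : ∀ x, HasDerivAt p (-(x / v) * p x) x := by
    intro x
    have h : HasDerivAt (fun x : ℝ => -(x - 0) ^ 2 / (2 * v)) (-(x / v)) x :=
      ((((hasDerivAt_id x).sub_const 0).pow 2).neg.div_const _).congr_deriv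
        (by simp; field_simp)
    refine ((h.exp).const_mul (√(2 * Real.pi * v))⁻¹).congr_deriv ?_
    rw [hp, gaussianPDFReal]
    ring
  have hpc : Continuous p := continuous_iff_continuousAt.2 fun x => (hpd x).continuousAt
  have hF : ∀ x, x ∉ s → HasDerivAt (fun x => p x * g x)
      (p x * g' x - (v : ℝ)⁻¹ * (p x * (x * g x))) x := fun x hx =>
    ((hpd x).mul (hd x hx)).congr_deriv (by ring)
  have hF' := hi'.sub (hi.const_mul (v : ℝ)⁻¹)
  have hlim := tendsto_gaussianPDFReal_mul_of_le_pow_three hv hg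
  have hftc : ∀ R : ℝ, ∫ x in (-R)..R, (p x * g' x - (v : ℝ)⁻¹ * (p x * (x * g x)))
      = p R * g R - p (-R) * g (-R) := fun R =>
    integral_eq_of_hasDerivAt_off_countable (fun x => p x * g x) _ hs (hpc.mul hc).continuousOn
      (fun x hx => hF x hx.2) hF'.intervalIntegrable
  have h1 := intervalIntegral_tendsto_integral hF' tendsto_neg_atTop_atBot tendsto_id
  have h2 : Tendsto (fun R : ℝ => p R * g R - p (-R) * g (-R)) atTop (nhds (0 - 0)) :=
    (hlim.mono_left atTop_le_cocompact).sub
      ((hlim.mono_left atBot_le_cocompact).comp tendsto_neg_atTop_atBot)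
  have h3 := tendsto_nhds_unique h1 (h2.congr fun R => (hftc R).symm)
  simp only [Pi.sub_apply] at h3
  rw [integral_sub hi' (hi.const_mul _), integral_const_mul, sub_zero] at h3
  field_simp at h3 ⊢
  linarith

lemma integrable_pow_gaussianReal (v : ℝ≥0) (k : ℕ) :
    Integrable (fun x => x ^ k) (gaussianReal 0 v) := by
  have := (memLp_id_gaussianReal (μ := 0) (v := v) k).integrable_norm_pow'
  simp only [id] at this
  refine this.mono' (by fun_prop) (ae_of_all _ fun x => by simp)

lemma integral_sq_gaussianReal (v : ℝ≥0) : ∫ x, x ^ 2 ∂gaussianReal 0 v = v := by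
  have h := variance_fun_id_gaussianReal (μ := 0) (v := v)
  rwa [variance_of_integral_eq_zero (by fun_prop) integral_id_gaussianReal] at h

lemma integral_pow_four_gaussianReal (v : ℝ≥0) :
    ∫ x, x ^ 4 ∂gaussianReal 0 v = 3 * (v : ℝ) ^ 2 := by
  have h := integral_mul_gaussianReal_eq v (g := fun x => x ^ 3) (g' := fun x => 3 * x ^ 2)
    (s := ∅) (A := 1) Set.countable_empty (by fun_prop)
    (fun x _ => by simpa using hasDerivAt_pow 3 x) (fun x => by simp)
    ((integrable_pow_gaussianReal v 4).congr (ae_of_all _ fun x => by ring))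
    ((integrable_pow_gaussianReal v 2).const_mul 3)
  rw [integral_const_mul, integral_sq_gaussianReal] at h
  rw [show (fun x : ℝ => x ^ 4) = fun x => x * x ^ 3 by ext; ring, h]
  ring

/-! ### Normal approximation of weighted sums of independent centred chi-squares -/

section ChiSquares

/-- Gaussian integration by parts for the Stein solution along `y ↦ a * (y ^ 2 - v) + s`. -/
lemma integral_sq_sub_mul_steinSol (v : ℝ≥0) {a : ℝ} (ha : a ≠ 0) (z s : ℝ) :
    ∫ y, (y ^ 2 - v) * steinSol z (a * (y ^ 2 - v) + s) ∂gaussianReal 0 v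
      = 2 * a * v * ∫ y, y ^ 2 * steinDeriv z (a * (y ^ 2 - v) + s) ∂gaussianReal 0 v := by
  set M := 1 + 1 / stdNormalPDF 1 with hM
  have hM0 : 0 ≤ M := (abs_nonneg _).trans (abs_steinSol_le 0 0)
  set h : ℝ → ℝ := fun y => a * (y ^ 2 - v) + s with hh
  have hc : Continuous fun y => steinSol z (h y) := (continuous_steinSol z).comp (by fun_prop)
  have hm : Measurable fun y => steinDeriv z (h y) := (measurable_steinDeriv z).comp (by fun_prop)
  have h2 := integrable_pow_gaussianReal v 2
  have i1 : Integrable (fun y => steinSol z (h y)) (gaussianReal 0 v) :=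
    (integrable_const M).mono' hc.aestronglyMeasurable (ae_of_all _ fun y => abs_steinSol_le _ _)
  have i2 : Integrable (fun y => y ^ 2 * steinSol z (h y)) (gaussianReal 0 v) :=
    h2.mul_bdd hc.aestronglyMeasurable (c := M) (ae_of_all _ fun y => abs_steinSol_le _ _)
  have i3 : Integrable (fun y => y ^ 2 * steinDeriv z (h y)) (gaussianReal 0 v) :=
    h2.mul_bdd hm.aestronglyMeasurable (c := 2) (ae_of_all _ fun y => abs_steinDeriv_le _ _)
  -- the Stein solution can fail to be differentiable along `h` only at the at most two roots of `h y = z`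
  have hs : ({y : ℝ | h y = z}).Countable := by
    set r := √(v + (z - s) / a) with hr
    refine Set.Countable.mono (s₂ := {r, -r}) (fun y hy => ?_) (Set.to_countable _)
    have hy' : y ^ 2 = v + (z - s) / a := by
      have : a * (y ^ 2 - v) + s = z := hy
      field_simp; linarith
    have : y ^ 2 = r ^ 2 := by rw [hr, Real.sq_sqrt (hy' ▸ sq_nonneg y), hy']
    exact sq_eq_sq_iff_eq_or_eq_neg.1 this
  have key := integral_mul_gaussianReal_eq v (g := fun y => y * steinSol z (h y))
    (g' := fun y => steinSol z (h y) + 2 * a * (y ^ 2 * steinDeriv z (h y))) (A := M) hs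
    (continuous_id.mul hc) (fun y hy => by
      have hd : HasDerivAt h (2 * a * y) y :=
        ((((hasDerivAt_pow 2 y).sub_const _).const_mul a).add_const s).congr_deriv
          (by norm_num; ring)
      refine ((hasDerivAt_id y).mul ((hasDerivAt_steinSol hy).comp y hd)).congr_deriv ?_
      simp only [id, Function.comp_apply]
      ring)
    (fun y => by
      rw [abs_mul, mul_comm]
      refine mul_le_mul (abs_steinSol_le _ _) ?_ (abs_nonneg y) hM0
      have := abs_nonneg y
      rcases le_total 1 |y| with h1 | h1
      · nlinarith [one_le_pow₀ h1 (n := 2), pow_succ |y| 2]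
      · nlinarith [pow_nonneg this 3])
    (i2.congr (ae_of_all _ fun y => by ring)) (i1.add (i3.const_mul _))
  rw [integral_add i1 (i3.const_mul _), integral_const_mul] at key
  have e : ∀ y, (y ^ 2 - v) * steinSol z (h y) = y * (y * steinSol z (h y))
      - v * steinSol z (h y) := fun y => by ring
  change ∫ y, (y ^ 2 - v) * steinSol z (h y) ∂_ = 2 * a * v * ∫ y, y ^ 2 * steinDeriv z (h y) ∂_
  simp_rw [e]
  rw [integral_sub (i2.congr (ae_of_all _ fun y => by ring)) (i1.const_mul _), key,
    integral_const_mul]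
  ring

variable {Ω : Type*} [MeasurableSpace Ω] {P : Measure Ω}

/-- The integration by parts of `integral_sq_sub_mul_steinSol` with an independent shift. -/
lemma ProbabilityTheory.IndepFun.integral_sq_sub_mul_steinSol
    [IsProbabilityMeasure P] {Y S : Ω → ℝ} {v : ℝ≥0}
    (hY : HasLaw Y (gaussianReal 0 v) P) (hS : AEMeasurable S P) (hYS : IndepFun Y S P)
    {a : ℝ} (ha : a ≠ 0) (z : ℝ) :
    ∫ ω, (Y ω ^ 2 - v) * steinSol z (a * (Y ω ^ 2 - v) + S ω) ∂P
      = 2 * a * v * ∫ ω, Y ω ^ 2 * steinDeriv z (a * (Y ω ^ 2 - v) + S ω) ∂P := by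
  have hlaw : HasLaw (fun ω => (Y ω, S ω)) ((gaussianReal 0 v).prod (P.map S)) P :=
    ⟨hY.aemeasurable.prodMk hS, by rw [hYS.map_prod_eq_prod_map_map hY.aemeasurable hS, hY.map_eq]⟩
  have : IsProbabilityMeasure (P.map S) := Measure.isProbabilityMeasure_map hS
  have hc : Measurable fun p : ℝ × ℝ => steinSol z (a * (p.1 ^ 2 - v) + p.2) :=
    (continuous_steinSol z).measurable.comp (by fun_prop)
  have hm : Measurable fun p : ℝ × ℝ => steinDeriv z (a * (p.1 ^ 2 - v) + p.2) :=
    (measurable_steinDeriv z).comp (by fun_prop)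
  have h2 := integrable_pow_gaussianReal v 2
  have i1 : Integrable (fun p : ℝ × ℝ => (p.1 ^ 2 - v) * steinSol z (a * (p.1 ^ 2 - v) + p.2))
      ((gaussianReal 0 v).prod (P.map S)) :=
    ((h2.sub (integrable_const (v : ℝ))).comp_fst _).mul_bdd hc.aestronglyMeasurable
      (ae_of_all _ fun y => abs_steinSol_le _ _)
  have i2 : Integrable (fun p : ℝ × ℝ => p.1 ^ 2 * steinDeriv z (a * (p.1 ^ 2 - v) + p.2))
      ((gaussianReal 0 v).prod (P.map S)) :=
    (h2.comp_fst _).mul_bdd hm.aestronglyMeasurable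
      (ae_of_all _ fun y => abs_steinDeriv_le _ _)
  have e1 := hlaw.integral_comp i1.aestronglyMeasurable
  have e2 := hlaw.integral_comp i2.aestronglyMeasurable
  simp only [Function.comp_def] at e1 e2
  rw [e1, e2, integral_prod_symm _ i1, integral_prod_symm _ i2, ← integral_const_mul]
  refine integral_congr_ae (ae_of_all _ fun s => ?_)
  exact _root_.integral_sq_sub_mul_steinSol v ha z s

lemma ProbabilityTheory.HasLaw.memLp_sq_sub {Y : Ω → ℝ} {v : ℝ≥0}
    (hY : HasLaw Y (gaussianReal 0 v) P) :
    MemLp (fun ω => Y ω ^ 2 - v) 2 P := by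
  have : IsProbabilityMeasure P := hY.isProbabilityMeasure
  have h : MemLp (fun y : ℝ => y ^ 2 - v) 2 (gaussianReal 0 v) := by
    refine MemLp.sub ?_ (memLp_const _)
    rw [memLp_two_iff_integrable_sq (by fun_prop)]
    exact (integrable_pow_gaussianReal v 4).congr (ae_of_all _ fun y => by simp; ring)
  rw [← hY.map_eq] at h
  exact h.comp_of_map hY.aemeasurable

lemma ProbabilityTheory.HasLaw.integral_sq_sub {Y : Ω → ℝ} {v : ℝ≥0}
    (hY : HasLaw Y (gaussianReal 0 v) P) :
    ∫ ω, (Y ω ^ 2 - v) ∂P = 0 := by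
  have h := hY.integral_comp (f := fun y : ℝ => y ^ 2 - v) (by fun_prop)
  simp only [Function.comp_def] at h
  rw [h, integral_sub (integrable_pow_gaussianReal v 2) (integrable_const _),
    integral_sq_gaussianReal]
  simp

lemma ProbabilityTheory.HasLaw.variance_sq_sub {Y : Ω → ℝ} {v : ℝ≥0}
    (hY : HasLaw Y (gaussianReal 0 v) P) :
    variance (fun ω => Y ω ^ 2 - v) P = 2 * (v : ℝ) ^ 2 := by
  rw [variance_of_integral_eq_zero hY.memLp_sq_sub.aemeasurable hY.integral_sq_sub]
  have h := hY.integral_comp (f := fun y : ℝ => (y ^ 2 - v) ^ 2) (by fun_prop)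
  simp only [Function.comp_def] at h
  have i2 := integrable_pow_gaussianReal v 2
  have i4 := integrable_pow_gaussianReal v 4
  rw [h, show (fun y : ℝ => (y ^ 2 - v) ^ 2) = fun y : ℝ => y ^ 4 - 2 * v * y ^ 2 + (v : ℝ) ^ 2 by
    ext; ring, integral_add (by exact i4.sub (i2.const_mul _)) (integrable_const _),
    integral_sub i4 (i2.const_mul _), integral_const_mul, integral_sq_gaussianReal,
    integral_pow_four_gaussianReal]
  simp; ring

variable {ι : Type*} [Fintype ι] {Y : ι → Ω → ℝ} {v : ι → ℝ≥0}

lemma variance_sum_mul_sq_sub (hY : ∀ i, HasLaw (Y i) (gaussianReal 0 (v i)) P)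
    (hI : iIndepFun Y P) (w : ι → ℝ) :
    variance (fun ω => ∑ i, w i * (Y i ω ^ 2 - v i)) P = ∑ i, w i ^ 2 * (2 * (v i : ℝ) ^ 2) := by
  have e : (fun ω => ∑ i, w i * (Y i ω ^ 2 - v i))
      = ∑ i, fun ω => w i * (Y i ω ^ 2 - v i) := by ext; simp
  rw [e, IndepFun.variance_sum (fun i _ => (hY i).memLp_sq_sub.const_mul _)]
  · refine Finset.sum_congr rfl fun i _ => ?_
    rw [variance_const_mul, (hY i).variance_sq_sub]
  · intro i _ j _ hij
    exact (hI.indepFun hij).comp (φ := fun y => w i * (y ^ 2 - v i))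
      (ψ := fun y => w j * (y ^ 2 - v j)) (by fun_prop) (by fun_prop)

/-- The Stein identity for `F = ∑ i, a * (Y i ^ 2 - v i)`. -/
lemma integral_mul_steinSol_sum_sq_sub [IsProbabilityMeasure P]
    (hY : ∀ i, HasLaw (Y i) (gaussianReal 0 (v i)) P) (hI : iIndepFun Y P) {a : ℝ} (ha : a ≠ 0)
    (z : ℝ) :
    ∫ ω, (∑ i, a * (Y i ω ^ 2 - v i)) * steinSol z (∑ i, a * (Y i ω ^ 2 - v i)) ∂P
      = ∫ ω, (∑ i, 2 * a ^ 2 * v i * Y i ω ^ 2)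
          * steinDeriv z (∑ i, a * (Y i ω ^ 2 - v i)) ∂P := by
  classical
  have hYm := fun i => (hY i).aemeasurable
  have hF : AEMeasurable (fun ω => ∑ i, a * (Y i ω ^ 2 - v i)) P :=
    Finset.aemeasurable_fun_sum _ fun i _ => (((hYm i).pow_const 2).sub_const _).const_mul a
  have i1 : ∀ i, Integrable (fun ω => (a * (Y i ω ^ 2 - v i))
      * steinSol z (∑ i, a * (Y i ω ^ 2 - v i))) P := fun i =>
    (((hY i).memLp_sq_sub.integrable one_le_two).const_mul a).mul_bdd
      ((continuous_steinSol z).measurable.comp_aemeasurable hF).aestronglyMeasurable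
      (ae_of_all _ fun y => abs_steinSol_le _ _)
  have hsq : ∀ i, Integrable (fun ω => Y i ω ^ 2) P := fun i =>
    (((hY i).memLp_sq_sub.integrable one_le_two).add (integrable_const (v i : ℝ))).congr
      (ae_of_all _ fun ω => by simp)
  have i2 : ∀ i, Integrable (fun ω => (2 * a ^ 2 * v i * Y i ω ^ 2)
      * steinDeriv z (∑ i, a * (Y i ω ^ 2 - v i))) P := fun i =>
    ((hsq i).const_mul _).mul_bdd
      ((measurable_steinDeriv z).comp_aemeasurable hF).aestronglyMeasurable
      (ae_of_all _ fun y => abs_steinDeriv_le _ _)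
  simp_rw [Finset.sum_mul]
  rw [integral_finsetSum _ fun i _ => i1 i, integral_finsetSum _ fun i _ => i2 i]
  refine Finset.sum_congr rfl fun i _ => ?_
  -- the remaining summands form a shift which is independent of `Y i`
  set S : Ω → ℝ := fun ω => ∑ j ∈ Finset.univ.erase i, a * (Y j ω ^ 2 - v j) with hS
  have hFS : ∀ ω, ∑ j, a * (Y j ω ^ 2 - v j) = a * (Y i ω ^ 2 - v i) + S ω := fun ω =>
    (Finset.add_sum_erase _ _ (Finset.mem_univ i)).symm
  have hSm : AEMeasurable S P :=
    Finset.aemeasurable_fun_sum _ fun i _ => (((hYm i).pow_const 2).sub_const _).const_mul a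
  have hind : IndepFun (Y i) S P := by
    have hφ : Measurable fun y : ({i} : Finset ι) → ℝ => y ⟨i, by simp⟩ := measurable_pi_apply _
    have hψ : Measurable fun y : ↥(Finset.univ.erase i) → ℝ =>
        ∑ j ∈ (Finset.univ.erase i).attach, a * (y j ^ 2 - v j) := by fun_prop
    have h := (hI.indepFun_finset₀ {i} (Finset.univ.erase i) (by simp) hYm).comp hφ hψ
    refine h.congr (ae_of_all _ fun ω => rfl) (ae_of_all _ fun ω => ?_)
    exact Finset.sum_attach (Finset.univ.erase i) fun j => a * (Y j ω ^ 2 - v j)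
  simp_rw [hFS, mul_assoc]
  rw [integral_const_mul, integral_const_mul, integral_const_mul, integral_const_mul,
    IndepFun.integral_sq_sub_mul_steinSol (hY i) hSm hind ha z]
  ring

/-- Stein's method bound: if `F = ∑ i, a * (Y i ^ 2 - v i)` with independent centred Gaussian `Y i`
of variances `v i ≤ L`, normalised to have unit variance, then the Kolmogorov distance of `F` to
the standard Gaussian law is at most `4 * a * L`. -/
lemma abs_measureReal_sum_sq_sub_le [IsProbabilityMeasure P]
    (hY : ∀ i, HasLaw (Y i) (gaussianReal 0 (v i)) P) (hI : iIndepFun Y P) {a L : ℝ} (ha : 0 < a)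
    (hv : ∑ i, 2 * a ^ 2 * (v i : ℝ) ^ 2 = 1) (hL : ∀ i, (v i : ℝ) ≤ L) (hL0 : 0 ≤ L) (z : ℝ) :
    |P.real {ω | ∑ i, a * (Y i ω ^ 2 - v i) ≤ z} - stdNormalCDF z| ≤ 4 * a * L := by
  have hYm := fun i => (hY i).aemeasurable
  set F : Ω → ℝ := fun ω => ∑ i, a * (Y i ω ^ 2 - v i) with hFdef
  set G : Ω → ℝ := fun ω => ∑ i, (2 * a ^ 2 * v i) * (Y i ω ^ 2 - v i) with hGdef
  have hF : AEMeasurable F P :=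
    Finset.aemeasurable_fun_sum _ fun i _ => (((hYm i).pow_const 2).sub_const _).const_mul a
  have hF2 : MemLp F 2 P := memLp_finsetSum _ fun i _ => (hY i).memLp_sq_sub.const_mul _
  have hG2 : MemLp G 2 P := memLp_finsetSum _ fun i _ => (hY i).memLp_sq_sub.const_mul _
  have hGsum : ∀ ω, ∑ i, 2 * a ^ 2 * v i * Y i ω ^ 2 = 1 + G ω := fun ω => by
    rw [← hv, ← Finset.sum_add_distrib]
    exact Finset.sum_congr rfl fun i _ => by ring
  have hdm : AEStronglyMeasurable (fun ω => steinDeriv z (F ω)) P :=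
    ((measurable_steinDeriv z).comp_aemeasurable hF).aestronglyMeasurable
  have hdi : Integrable (fun ω => steinDeriv z (F ω)) P :=
    (integrable_const (2 : ℝ)).mono' hdm (ae_of_all _ fun ω => abs_steinDeriv_le _ _)
  have hFi : Integrable (fun ω => F ω * steinSol z (F ω)) P :=
    (hF2.integrable one_le_two).mul_bdd
      ((continuous_steinSol z).measurable.comp_aemeasurable hF).aestronglyMeasurable
      (ae_of_all _ fun y => abs_steinSol_le _ _)
  have hGi : Integrable (fun ω => G ω * steinDeriv z (F ω)) P :=
    (hG2.integrable one_le_two).mul_bdd hdm (ae_of_all _ fun y => abs_steinDeriv_le _ _)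
  have hset : NullMeasurableSet {ω | F ω ≤ z} P := nullMeasurableSet_le hF aemeasurable_const
  have h1 : P.real {ω | F ω ≤ z} - stdNormalCDF z
      = ∫ ω, (steinDeriv z (F ω) - F ω * steinSol z (F ω)) ∂P := by
    have e : ∀ ω, steinDeriv z (F ω) - F ω * steinSol z (F ω)
        = Set.indicator {ω | F ω ≤ z} 1 ω - stdNormalCDF z := fun ω => by
      rw [steinDeriv, add_sub_cancel_left]; rfl
    simp_rw [e]
    rw [integral_sub, integral_indicator₀ hset]
    · simp
    · exact (integrable_const (1 : ℝ)).indicator₀ hset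
    · exact integrable_const _
  have h2 : P.real {ω | F ω ≤ z} - stdNormalCDF z = -∫ ω, G ω * steinDeriv z (F ω) ∂P := by
    rw [h1, integral_sub hdi hFi, integral_mul_steinSol_sum_sq_sub hY hI ha.ne' z]
    simp_rw [hGsum, add_mul, one_mul]
    rw [integral_add hdi hGi]
    ring
  have h3 : |∫ ω, G ω * steinDeriv z (F ω) ∂P| ≤ (∫ ω, |G ω| ∂P) * 2 := by
    rw [← integral_mul_const]
    refine (abs_integral_le_integral_abs).trans ?_
    refine integral_mono hGi.abs ((hG2.integrable one_le_two).abs.mul_const 2) fun ω => ?_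
    simp only [abs_mul]
    exact mul_le_mul_of_nonneg_left (abs_steinDeriv_le _ _) (abs_nonneg _)
  have hG0 : ∫ ω, G ω ∂P = 0 := by
    rw [hGdef, integral_finsetSum _ fun i _ =>
      ((hY i).memLp_sq_sub.integrable one_le_two).const_mul _]
    refine Finset.sum_eq_zero fun i _ => ?_
    rw [integral_const_mul, (hY i).integral_sq_sub, mul_zero]
  -- Jensen's inequality and the explicit variance of `G`
  have h4 : (∫ ω, |G ω| ∂P) ^ 2 ≤ (2 * a * L) ^ 2 := by
    have hv1 : (∫ ω, |G ω| ∂P) ^ 2 ≤ ∫ ω, G ω ^ 2 ∂P := by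
      have := variance_nonneg |G| P
      rw [variance_eq_sub hG2.abs] at this
      simp only [Pi.pow_apply, Pi.abs_apply, sq_abs] at this
      linarith
    have hv2 := variance_sum_mul_sq_sub hY hI fun i => 2 * a ^ 2 * v i
    rw [variance_of_integral_eq_zero hG2.aemeasurable hG0] at hv2
    rw [hv2] at hv1
    refine hv1.trans ?_
    calc ∑ i, (2 * a ^ 2 * v i) ^ 2 * (2 * (v i : ℝ) ^ 2)
        ≤ ∑ i, (2 * a * L) ^ 2 * (2 * a ^ 2 * (v i : ℝ) ^ 2) := by
          refine Finset.sum_le_sum fun i _ => ?_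
          have hvL : (v i : ℝ) ^ 2 ≤ L ^ 2 := pow_le_pow_left₀ (v i).2 (hL i) 2
          calc _ = 8 * a ^ 4 * (v i : ℝ) ^ 2 * (v i : ℝ) ^ 2 := by ring
            _ ≤ 8 * a ^ 4 * (v i : ℝ) ^ 2 * L ^ 2 := by gcongr
            _ = _ := by ring
      _ = (2 * a * L) ^ 2 := by rw [← Finset.mul_sum, hv, mul_one]
  have h5 := abs_le_of_sq_le_sq h4 (by positivity)
  rw [h2, abs_neg]
  linarith [le_abs_self (∫ ω, |G ω| ∂P)]

end ChiSquares

/-! ### Centred squares of Gaussian vectors -/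

section Diagonalisation

open Matrix

variable {ι : Type*} [Fintype ι] [DecidableEq ι]

lemma Matrix.exists_orthogonal_diagonal {C : Matrix ι ι ℝ} (hC : C.IsSymm) :
    ∃ (U : Matrix ι ι ℝ) (d : ι → ℝ), U * Uᵀ = 1 ∧ Uᵀ * U = 1 ∧ C * U = U * diagonal d := by
  have hH : C.IsHermitian := by rwa [IsHermitian, conjTranspose_eq_transpose_of_trivial]
  set U : Matrix ι ι ℝ := hH.eigenvectorUnitary.1 with hU
  have hst : star U = Uᵀ := by rw [star_eq_conjTranspose, conjTranspose_eq_transpose_of_trivial]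
  have h1 : U * Uᵀ = 1 := hst ▸ Unitary.coe_mul_star_self hH.eigenvectorUnitary
  have h2 : Uᵀ * U = 1 := hst ▸ Unitary.coe_star_mul_self hH.eigenvectorUnitary
  refine ⟨U, hH.eigenvalues, h1, h2, ?_⟩
  ext i j
  have := congrFun (hH.mulVec_eigenvectorBasis j) i
  rw [mul_diagonal, mul_comm]
  simpa [hU, mulVec, dotProduct, Matrix.mul_apply, IsHermitian.eigenvectorUnitary_apply] using this

/-- The eigenvalues of a matrix are bounded by its absolute row sums. -/
lemma Matrix.le_of_mul_eq_mul_diagonal {C U : Matrix ι ι ℝ} {d : ι → ℝ} (hU : Uᵀ * U = 1)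
    (hCU : C * U = U * diagonal d) {L : ℝ} (hL : ∀ i, ∑ j, |C i j| ≤ L) (k : ι) : d k ≤ L := by
  obtain ⟨i, -, hi⟩ := Finset.exists_max_image Finset.univ (fun i => |U i k|) ⟨k, Finset.mem_univ k⟩
  have hpos : 0 < |U i k| := by
    by_contra! h
    have h0 : ∀ j, U j k = 0 := fun j =>
      abs_nonpos_iff.1 ((hi j (Finset.mem_univ j)).trans h)
    have := congrFun (congrFun hU k) k
    simp [Matrix.mul_apply, h0] at this
  have h := congrFun (congrFun hCU i) k
  rw [mul_diagonal, Matrix.mul_apply] at h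
  refine le_of_mul_le_mul_left ?_ hpos
  calc |U i k| * d k ≤ |U i k * d k| := by
        rw [abs_mul]; exact mul_le_mul_of_nonneg_left (le_abs_self _) (abs_nonneg _)
    _ = |∑ j, C i j * U j k| := by rw [h]
    _ ≤ ∑ j, |C i j| * |U i k| := (Finset.abs_sum_le_sum_abs _ _).trans
        (Finset.sum_le_sum fun j hj => by
          rw [abs_mul]; exact mul_le_mul_of_nonneg_left (hi j hj) (abs_nonneg _))
    _ ≤ |U i k| * L := by
        rw [← Finset.sum_mul, mul_comm]; exact mul_le_mul_of_nonneg_left (hL i) (abs_nonneg _)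

lemma Matrix.sum_sq_eq_of_mul_eq_mul_diagonal {C U : Matrix ι ι ℝ} {d : ι → ℝ} (hC : C.IsSymm)
    (hU : U * Uᵀ = 1) (hCU : C * U = U * diagonal d) :
    ∑ k, d k ^ 2 = ∑ i, ∑ j, C i j ^ 2 := by
  have hU' : Uᵀ * U = 1 := mul_eq_one_comm.1 hU
  have h1 : trace (diagonal d * diagonal d) = ∑ k, d k ^ 2 := by
    simp [trace, diagonal_mul_diagonal, sq]
  have h2 : trace (C * C) = ∑ i, ∑ j, C i j ^ 2 := by
    simp only [trace, diag_apply, Matrix.mul_apply, sq]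
    exact Finset.sum_congr rfl fun i _ => Finset.sum_congr rfl fun j _ => by rw [hC.apply i j]
  have h3 : Uᵀ * (C * C * U) = diagonal d * diagonal d := by
    rw [mul_assoc, hCU, ← mul_assoc, ← mul_assoc, mul_assoc Uᵀ, hCU, ← mul_assoc, hU', one_mul]
  rw [← h1, ← h2, ← h3, trace_mul_comm, mul_assoc, hU, mul_one]

end Diagonalisation

section GaussianVector

variable {Ω ι : Type*} [MeasurableSpace Ω] {P : Measure Ω} [Fintype ι] {X : ι → Ω → ℝ}

/-- A centred Gaussian vector can be rotated into a vector of independent centred Gaussian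
variables, whose variances are the eigenvalues of the covariance matrix `C`. -/
lemma exists_independent_rotation (hX : HasGaussianLaw (fun ω => (X · ω)) P)
    (h0 : ∀ i, ∫ ω, X i ω ∂P = 0) {C : ι → ι → ℝ} (hC : ∀ i j, ∫ ω, X i ω * X j ω ∂P = C i j)
    {L : ℝ} (hL : ∀ i, ∑ j, |C i j| ≤ L) :
    ∃ (Y : ι → Ω → ℝ) (v : ι → ℝ≥0), (∀ i, HasLaw (Y i) (gaussianReal 0 (v i)) P) ∧
      iIndepFun Y P ∧ (∀ ω, ∑ i, Y i ω ^ 2 = ∑ i, X i ω ^ 2) ∧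
      (∑ i, (v i : ℝ) ^ 2 = ∑ i, ∑ j, C i j ^ 2) ∧ ∀ i, (v i : ℝ) ≤ L := by
  classical
  have : IsProbabilityMeasure P := hX.isProbabilityMeasure
  have hsymm : (Matrix.of C).IsSymm := by
    ext i j
    simp only [Matrix.transpose_apply, Matrix.of_apply]
    rw [← hC, ← hC]
    simp_rw [mul_comm]
  obtain ⟨U, d, hU1, hU2, hCU⟩ := Matrix.exists_orthogonal_diagonal hsymm
  have hX2 : ∀ i, MemLp (X i) 2 P := fun i => (hX.eval i).memLp_two
  have hcovX : ∀ i j, cov[X i, X j; P] = C i j := fun i j => by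
    rw [covariance_eq_sub (hX2 i) (hX2 j), h0, h0, ← hC]; simp
  set Y : ι → Ω → ℝ := fun k ω => ∑ i, U i k * X i ω with hY
  have hYG : HasGaussianLaw (fun ω => (Y · ω)) P :=
    hX.map_fun (LinearMap.toContinuousLinearMap (Matrix.mulVecLin U.transpose)) |>.congr
      (ae_of_all _ fun ω => by
        ext k
        simp [hY, Matrix.vecMul, dotProduct, mul_comm])
  have hcovY : ∀ k l, cov[Y k, Y l; P] = Matrix.diagonal d k l := fun k l => by
    have : U.transpose * (Matrix.of C * U) = Matrix.diagonal d := by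
      rw [hCU, ← mul_assoc, hU2, one_mul]
    rw [← this, hY]
    rw [covariance_fun_sum_fun_sum (fun i => (hX2 i).const_mul _) (fun i => (hX2 i).const_mul _)]
    simp only [Matrix.mul_apply, Matrix.transpose_apply, Matrix.of_apply, Finset.mul_sum]
    refine Finset.sum_congr rfl fun i _ => Finset.sum_congr rfl fun j _ => ?_
    rw [covariance_const_mul_left, covariance_const_mul_right, hcovX]
    ring
  have hvar : ∀ k, variance (Y k) P = d k := fun k => by
    rw [← covariance_self (hYG.eval k).aemeasurable, hcovY, Matrix.diagonal_apply_eq]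
  have hd0 : ∀ k, 0 ≤ d k := fun k => hvar k ▸ variance_nonneg _ _
  have hcoe : ∀ k, ((d k).toNNReal : ℝ) = d k := fun k => Real.coe_toNNReal _ (hd0 k)
  refine ⟨Y, fun k => (d k).toNNReal, fun k => ⟨(hYG.eval k).aemeasurable, ?_⟩, ?_, ?_, ?_, ?_⟩
  · have hm : ∫ ω, Y k ω ∂P = 0 := by
      rw [hY, integral_finsetSum _ fun i _ => ((hX2 i).integrable one_le_two).const_mul _]
      exact Finset.sum_eq_zero fun i _ => by rw [integral_const_mul, h0, mul_zero]
    rw [(hYG.eval k).map_eq_gaussianReal, hvar, hm]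
  · exact hYG.iIndepFun_of_covariance_eq_zero fun i j hij => by
      rw [hcovY, Matrix.diagonal_apply_ne _ hij]
  · intro ω
    have e1 : ∑ k, Y k ω ^ 2 = Matrix.vecMul (X · ω) U ⬝ᵥ Matrix.mulVec U.transpose (X · ω) := by
      simp only [hY, dotProduct, Matrix.vecMul, Matrix.mulVec, Matrix.transpose_apply, sq]
      exact Finset.sum_congr rfl fun k _ => by simp_rw [mul_comm (X _ ω)]
    rw [e1, ← Matrix.dotProduct_mulVec, Matrix.mulVec_mulVec, hU1, Matrix.one_mulVec]
    simp [dotProduct, sq]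
  · simp_rw [hcoe]
    exact Matrix.sum_sq_eq_of_mul_eq_mul_diagonal hsymm hU1 hCU
  · intro k
    rw [hcoe]
    exact Matrix.le_of_mul_eq_mul_diagonal hU2 hCU hL k

/-- Berry–Esseen type bound for the centred squared norm of a Gaussian vector: the Kolmogorov
distance of its normalisation to the standard Gaussian law is controlled by the largest absolute row
sum of the covariance matrix divided by its Frobenius norm. -/
lemma abs_measureReal_div_sqrt_variance_sub_le (hX : HasGaussianLaw (fun ω => (X · ω)) P)
    (h0 : ∀ i, ∫ ω, X i ω ∂P = 0) {C : ι → ι → ℝ} (hC : ∀ i j, ∫ ω, X i ω * X j ω ∂P = C i j)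
    {L : ℝ} (hL : ∀ i, ∑ j, |C i j| ≤ L) (hL0 : 0 ≤ L) (hpos : 0 < ∑ i, ∑ j, C i j ^ 2)
    {Z : Ω → ℝ} (hZ : ∀ ω, Z ω = ∑ i, (X i ω ^ 2 - C i i)) (z : ℝ) :
    |P.real {ω | Z ω / √(variance Z P) ≤ z} - stdNormalCDF z|
      ≤ 4 * L / √(2 * ∑ i, ∑ j, C i j ^ 2) := by
  have : IsProbabilityMeasure P := hX.isProbabilityMeasure
  obtain ⟨Y, v, hY, hI, hYX, hv, hvL⟩ := exists_independent_rotation hX h0 hC hL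
  have hY2 : ∀ i, Integrable (fun ω => Y i ω ^ 2) P := fun i =>
    (((hY i).memLp_sq_sub.integrable one_le_two).add (integrable_const (v i : ℝ))).congr
      (ae_of_all _ fun ω => by simp)
  have hX2 : ∀ i, Integrable (fun ω => X i ω ^ 2) P := fun i =>
    ((hX.eval i).memLp_two).integrable_sq
  have htr : ∑ i, C i i = ∑ i, (v i : ℝ) := by
    have h : ∫ ω, ∑ i, Y i ω ^ 2 ∂P = ∫ ω, ∑ i, X i ω ^ 2 ∂P := by simp_rw [hYX]
    rw [integral_finsetSum _ fun i _ => hY2 i, integral_finsetSum _ fun i _ => hX2 i] at h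
    have e1 : ∀ i, ∫ ω, Y i ω ^ 2 ∂P = v i := fun i => by
      have := (hY i).integral_sq_sub
      rw [integral_sub (hY2 i) (integrable_const _)] at this
      simp at this
      linarith
    simp_rw [e1] at h
    rw [h]
    exact Finset.sum_congr rfl fun i _ => by rw [← hC]; simp_rw [sq]
  have hZY : ∀ ω, Z ω = ∑ i, (Y i ω ^ 2 - v i) := fun ω => by
    rw [hZ, Finset.sum_sub_distrib, Finset.sum_sub_distrib, hYX, htr]
  have hvar : variance Z P = 2 * ∑ i, ∑ j, C i j ^ 2 := by
    have := variance_sum_mul_sq_sub hY hI fun _ => 1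
    simp only [one_mul, one_pow] at this
    rw [show Z = fun ω => ∑ i, (Y i ω ^ 2 - (v i : ℝ)) from funext hZY, this, ← Finset.mul_sum, hv]
  rw [hvar]
  set σ := √(2 * ∑ i, ∑ j, C i j ^ 2) with hσ
  have hσ0 : 0 < σ := Real.sqrt_pos.2 (by positivity)
  have hσ2 : σ ^ 2 = 2 * ∑ i, ∑ j, C i j ^ 2 := Real.sq_sqrt (by positivity)
  have key := abs_measureReal_sum_sq_sub_le hY hI (a := 1 / σ) (by positivity) (by
    rw [← Finset.mul_sum, hv, div_pow, one_pow, hσ2]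
    field_simp) hvL hL0 z
  have e : ∀ ω, ∑ i, 1 / σ * (Y i ω ^ 2 - v i) = Z ω / σ := fun ω => by
    rw [← Finset.mul_sum, hZY]; ring
  simp_rw [e] at key
  exact key.trans_eq (by ring)

end GaussianVector

/-! ### Kolmogorov distance and convergence in distribution -/

section Kolmogorov

variable {Ω Ω' : Type*} [MeasurableSpace Ω] [MeasurableSpace Ω'] {P : Measure Ω} {Q : Measure Ω'}

lemma abs_measureReal_sub_measureReal_le_one [IsProbabilityMeasure P] [IsProbabilityMeasure Q]
    (s : Set Ω) (t : Set Ω') : |P.real s - Q.real t| ≤ 1 := by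
  have h1 : 0 ≤ P.real s := measureReal_nonneg
  have h2 : P.real s ≤ 1 := measureReal_le_one
  have h3 : 0 ≤ Q.real t := measureReal_nonneg
  have h4 : Q.real t ≤ 1 := measureReal_le_one
  rw [abs_le]
  constructor <;> linarith

lemma kolmogorovDist_le_one [IsProbabilityMeasure P] [IsProbabilityMeasure Q]
    (Y : Ω → ℝ) (Z : Ω' → ℝ) : kolmogorovDist Y P Z Q ≤ 1 :=
  ciSup_le fun _ => abs_measureReal_sub_measureReal_le_one _ _

lemma abs_measureReal_sub_le_kolmogorovDist [IsProbabilityMeasure P] [IsProbabilityMeasure Q]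
    (Y : Ω → ℝ) (Z : Ω' → ℝ) (z : ℝ) :
    |P.real {ω | Y ω ≤ z} - Q.real {ω | Z ω ≤ z}| ≤ kolmogorovDist Y P Z Q :=
  le_ciSup (f := fun z : ℝ => |P.real {ω | Y ω ≤ z} - Q.real {ω | Z ω ≤ z}|)
    ⟨1, by rintro _ ⟨z, rfl⟩; exact abs_measureReal_sub_measureReal_le_one _ _⟩ z

lemma map_measureReal_Ioc [IsProbabilityMeasure P] {V : Ω → ℝ} (hV : AEMeasurable V P) {a b : ℝ}
    (hab : a ≤ b) :
    (P.map V).real (Set.Ioc a b) = P.real {ω | V ω ≤ b} - P.real {ω | V ω ≤ a} := by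
  have : IsProbabilityMeasure (P.map V) := Measure.isProbabilityMeasure_map hV
  rw [← Set.Iic_sdiff_Iic, measureReal_sdiff (Set.Iic_subset_Iic.2 hab) measurableSet_Iic,
    map_measureReal_apply_of_aemeasurable hV measurableSet_Iic,
    map_measureReal_apply_of_aemeasurable hV measurableSet_Iic]
  rfl

/-- Convergence in Kolmogorov distance implies convergence in distribution. -/
lemma tendstoInDistribution_of_tendsto_kolmogorovDist [IsProbabilityMeasure P]
    [IsProbabilityMeasure Q] {V : ℕ → Ω → ℝ} {N : Ω' → ℝ} (hV : ∀ n, AEMeasurable (V n) P)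
    (hN : AEMeasurable N Q)
    (h : Tendsto (fun n => kolmogorovDist (V n) P N Q) atTop (nhds 0)) :
    TendstoInDistribution V atTop N (fun _ => P) Q := by
  refine ⟨hV, hN, ?_⟩
  have hcdf : ∀ z, Tendsto (fun n => P.real {ω | V n ω ≤ z}) atTop
      (nhds (Q.real {ω | N ω ≤ z})) := fun z => by
    rw [tendsto_iff_dist_tendsto_zero]
    exact squeeze_zero (fun _ => dist_nonneg)
      (fun n => abs_measureReal_sub_le_kolmogorovDist (V n) N z) h
  refine (isPiSystem_Ioc (id : ℝ → ℝ) id).tendsto_probabilityMeasure_of_tendsto_of_mem ?_ ?_ ?_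
  · rintro _ ⟨a, b, -, rfl⟩
    exact measurableSet_Ioc
  · intro u hu x hx
    obtain ⟨ε, hε, hball⟩ := Metric.isOpen_iff.1 hu x hx
    refine ⟨_, ⟨x - ε / 2, x + ε / 2, by simp only [id]; linarith, rfl⟩,
      Ioc_mem_nhds (by simp only [id]; linarith) (by simp only [id]; linarith), fun y hy => hball ?_⟩
    rw [Metric.mem_ball, Real.dist_eq, abs_lt]
    simp only [id, Set.mem_Ioc] at hy
    constructor <;> linarith
  · rintro _ ⟨a, b, hlt, rfl⟩
    have hab : a ≤ b := le_of_lt hlt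
    refine NNReal.tendsto_coe.1 ?_
    change Tendsto (fun n => (P.map (V n)).real (Set.Ioc a b)) atTop
      (nhds ((Q.map N).real (Set.Ioc a b)))
    rw [map_measureReal_Ioc hN hab]
    simp_rw [fun n => map_measureReal_Ioc (hV n) hab]
    exact (hcdf b).sub (hcdf a)

end Kolmogorov

/-! ### Increments of bifractional Brownian motion -/

/-- The mixed second difference of `(s, t) ↦ (s ^ (2 * H) + t ^ (2 * H)) ^ K` over the unit square
with lower left corner `(i, j)`. -/
noncomputable def powSumDiff (H K : ℝ) (i j : ℕ) : ℝ :=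
  (((i : ℝ) + 1) ^ (2 * H) + ((j : ℝ) + 1) ^ (2 * H)) ^ K
    - (((i : ℝ) + 1) ^ (2 * H) + (j : ℝ) ^ (2 * H)) ^ K
    - ((i : ℝ) ^ (2 * H) + ((j : ℝ) + 1) ^ (2 * H)) ^ K
    + ((i : ℝ) ^ (2 * H) + (j : ℝ) ^ (2 * H)) ^ K

/-- The second difference of `|x| ^ a` at `x = i - j`, that is, twice the covariance function of
fractional Gaussian noise of Hurst index `a / 2`. -/
noncomputable def absPowDiff (a : ℝ) (i j : ℕ) : ℝ :=
  |(i : ℝ) - j + 1| ^ a + |(i : ℝ) - j - 1| ^ a - 2 * |(i : ℝ) - j| ^ a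

/-- The covariance of the unit increments of bifractional Brownian motion started at `i` and `j`. -/
noncomputable def bifIncrCov (H K : ℝ) (i j : ℕ) : ℝ :=
  1 / 2 ^ K * (powSumDiff H K i j + absPowDiff (2 * H * K) i j)

lemma bifBmCov_div (H K : ℝ) (s t : ℝ≥0) {n : ℕ} (hn : n ≠ 0) :
    (n : ℝ) ^ (2 * H * K) * bifBmCov H K (s / n) (t / n) = bifBmCov H K s t := by
  have hn' : (0 : ℝ) < n := by positivity
  have h1 : ∀ x y : ℝ, 0 ≤ x → 0 ≤ y →
      (n : ℝ) ^ (2 * H * K) * ((x / n) ^ (2 * H) + (y / n) ^ (2 * H)) ^ K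
        = (x ^ (2 * H) + y ^ (2 * H)) ^ K := fun x y hx hy => by
    rw [Real.rpow_mul hn'.le, ← Real.mul_rpow (by positivity) (by positivity), mul_add,
      ← Real.mul_rpow hn'.le (by positivity), ← Real.mul_rpow hn'.le (by positivity),
      mul_div_cancel₀ _ hn'.ne', mul_div_cancel₀ _ hn'.ne']
  have h2 : (n : ℝ) ^ (2 * H * K) * |(t : ℝ) / n - s / n| ^ (2 * H * K)
      = |(t : ℝ) - s| ^ (2 * H * K) := by
    rw [← Real.mul_rpow hn'.le (abs_nonneg _), ← sub_div, abs_div, abs_of_pos hn',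
      mul_div_cancel₀ _ hn'.ne']
  rw [bifBmCov, bifBmCov, ← h1 t s t.2 s.2, ← h2]
  push_cast
  ring

lemma bifBmCov_increment (H K : ℝ) (i j : ℕ) :
    bifBmCov H K ((i : ℝ≥0) + 1) ((j : ℝ≥0) + 1) - bifBmCov H K ((i : ℝ≥0) + 1) j
      - bifBmCov H K i ((j : ℝ≥0) + 1) + bifBmCov H K i j = bifIncrCov H K i j := by
  have e1 : |(j : ℝ) - (i + 1)| = |(i : ℝ) - j + 1| := by
    rw [← abs_neg]; ring_nf
  have e2 : |(j : ℝ) + 1 - i| = |(i : ℝ) - j - 1| := by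
    rw [← abs_neg]; ring_nf
  have e3 : |(j : ℝ) - i| = |(i : ℝ) - j| := abs_sub_comm _ _
  simp only [bifBmCov, bifIncrCov, powSumDiff, absPowDiff, NNReal.coe_add, NNReal.coe_natCast,
    NNReal.coe_one, add_sub_add_right_eq_sub, e1, e2, e3]
  rw [add_comm ((j : ℝ) ^ (2 * H)), add_comm (((j : ℝ) + 1) ^ (2 * H)),
    add_comm (((j : ℝ) + 1) ^ (2 * H)), add_comm ((j : ℝ) ^ (2 * H))]
  ring

namespace IsBifractionalBM

variable {Ω : Type*} [MeasurableSpace Ω] {P : Measure Ω} {H K : ℝ} {B : ℝ≥0 → Ω → ℝ}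

lemma memLp_two (hB : IsBifractionalBM H K B P) (t : ℝ≥0) : MemLp (B t) 2 P :=
  (hB.isGaussianProcess.hasGaussianLaw_eval t).memLp_two

/-- Self-similarity of the increments at the level of covariances. -/
lemma integral_increment_mul_increment (hB : IsBifractionalBM H K B P) {n : ℕ} (hn : n ≠ 0)
    (i j : ℕ) :
    (n : ℝ) ^ (2 * H * K) * ∫ ω, (B (((i : ℝ≥0) + 1) / n) ω - B ((i : ℝ≥0) / n) ω)
      * (B (((j : ℝ≥0) + 1) / n) ω - B ((j : ℝ≥0) / n) ω) ∂P = bifIncrCov H K i j := by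
  have hi : ∀ s t, Integrable (fun ω => B s ω * B t ω) P := fun s t =>
    (hB.memLp_two s).integrable_mul (hB.memLp_two t)
  have e : ∀ s t u v : ℝ≥0, ∫ ω, (B s ω - B t ω) * (B u ω - B v ω) ∂P
      = bifBmCov H K s u - bifBmCov H K s v - bifBmCov H K t u + bifBmCov H K t v := by
    intro s t u v
    rw [← hB.covariance, ← hB.covariance, ← hB.covariance, ← hB.covariance,
      ← integral_sub (hi _ _) (hi _ _), ← integral_sub (by exact (hi _ _).sub (hi _ _)) (hi _ _),
      ← integral_add (by exact ((hi _ _).sub (hi _ _)).sub (hi _ _)) (hi _ _)]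
    exact integral_congr_ae (ae_of_all _ fun ω => by ring)
  rw [e, mul_add, mul_sub, mul_sub, bifBmCov_div _ _ _ _ hn, bifBmCov_div _ _ _ _ hn,
    bifBmCov_div _ _ _ _ hn, bifBmCov_div _ _ _ _ hn, bifBmCov_increment]

lemma aemeasurable_normQuadVar (hB : IsBifractionalBM H K B P) (n : ℕ) :
    AEMeasurable (normQuadVar H K B P n) P := by
  have hm := fun t => hB.isGaussianProcess.aemeasurable t
  refine AEMeasurable.div_const (Finset.aemeasurable_fun_sum _ fun i _ => ?_) _
  exact ((((hm _).sub (hm _)).pow_const 2).const_mul _).sub_const _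

/-- The Kolmogorov distance of the normalised quadratic variation to the standard Gaussian law, in
terms of the covariance matrix of the increments. -/
lemma kolmogorovDist_normQuadVar_le (hB : IsBifractionalBM H K B P) {Ω' : Type*}
    [MeasurableSpace Ω'] {Q : Measure Ω'} {N : Ω' → ℝ} (hN : HasLaw N (gaussianReal 0 1) Q)
    {n : ℕ} (hn : n ≠ 0) {L : ℝ}
    (hL : ∀ i < n, ∑ j ∈ Finset.range n, |bifIncrCov H K i j| ≤ L) (hL0 : 0 ≤ L)
    (hpos : 0 < ∑ i ∈ Finset.range n, ∑ j ∈ Finset.range n, bifIncrCov H K i j ^ 2) :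
    kolmogorovDist (normQuadVar H K B P n) P N Q
      ≤ 4 * L / √(2 * ∑ i ∈ Finset.range n, ∑ j ∈ Finset.range n, bifIncrCov H K i j ^ 2) := by
  have := hB.isGaussianProcess.isProbabilityMeasure
  refine ciSup_le fun z => ?_
  have hNz : Q.real {ω | N ω ≤ z} = stdNormalCDF z := hN.measureReal_eq measurableSet_Iic
  rw [hNz]
  set c : ℝ := (n : ℝ) ^ (H * K) with hc
  have hc2 : c ^ 2 = (n : ℝ) ^ (2 * H * K) := by
    rw [hc, ← Real.rpow_natCast, ← Real.rpow_mul (by positivity)]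
    congr 1
    push_cast
    ring
  set X : Fin n → Ω → ℝ := fun i ω => c * (B (((i : ℕ) + 1) / n) ω - B ((i : ℕ) / n) ω) with hX
  have hXG : HasGaussianLaw (fun ω => (X · ω)) P := by
    have h := hB.isGaussianProcess.hasGaussianLaw_increments
      (t := fun k : Fin (n + 1) => ((k : ℕ) : ℝ≥0) / n)
    refine (h.fun_smul c).congr (ae_of_all _ fun ω => ?_)
    ext i
    simp [hX]
  have hX0 : ∀ i, ∫ ω, X i ω ∂P = 0 := fun i => by
    rw [hX, integral_const_mul, integral_sub ((hB.memLp_two _).integrable one_le_two)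
      ((hB.memLp_two _).integrable one_le_two), hB.centered, hB.centered]
    simp
  have hXC : ∀ i j, ∫ ω, X i ω * X j ω ∂P = bifIncrCov H K i j := fun i j => by
    rw [← hB.integral_increment_mul_increment hn, ← hc2, ← integral_const_mul]
    exact integral_congr_ae (ae_of_all _ fun ω => by simp only [hX]; ring)
  have hunit : ∀ i : ℕ, ∫ ω, (B ((i : ℝ≥0) + 1) ω - B (i : ℝ≥0) ω) ^ 2 ∂P
      = bifIncrCov H K i i := fun i => by
    rw [← hB.integral_increment_mul_increment one_ne_zero]
    simp [sq]
  have hZ : ∀ ω, quadVar H K B P n ω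
      = ∑ i, (X i ω ^ 2 - bifIncrCov H K (i : Fin n) i) := fun ω => by
    rw [quadVar, Finset.sum_range]
    refine Finset.sum_congr rfl fun i _ => ?_
    rw [hunit, hX, mul_pow, hc2]
  simp only [Finset.sum_range] at hL hpos ⊢
  exact abs_measureReal_div_sqrt_variance_sub_le hXG hX0 hXC (fun i => hL i i.2) hL0 hpos hZ z

end IsBifractionalBM

/-! ### Estimates on powers -/

/-- A concave function composed with addition has nonpositive mixed second differences. -/
lemma ConcaveOn.crossDiff_nonpos {f : ℝ → ℝ} (hf : ConcaveOn ℝ (Set.Ici 0) f) {u x y : ℝ}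
    (hu : 0 ≤ u) (hx : 0 ≤ x) (hy : 0 ≤ y) :
    f (u + x + y) - f (u + x) - f (u + y) + f u ≤ 0 := by
  rcases eq_or_lt_of_le hx with rfl | hx'
  · simp
  have hs : 0 < x + y := by linarith
  have h0 : u ∈ Set.Ici (0 : ℝ) := hu
  have h1 : u + x + y ∈ Set.Ici (0 : ℝ) := by simp only [Set.mem_Ici]; linarith
  have key1 := hf.2 h0 h1 (div_nonneg hy hs.le) (div_nonneg hx hs.le) (by field_simp; ring)
  have key2 := hf.2 h0 h1 (div_nonneg hx hs.le) (div_nonneg hy hs.le) (by field_simp)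
  simp only [smul_eq_mul] at key1 key2
  rw [show y / (x + y) * u + x / (x + y) * (u + x + y) = u + x by field_simp; ring] at key1
  rw [show x / (x + y) * u + y / (x + y) * (u + x + y) = u + y by field_simp; ring] at key2
  have e : x / (x + y) = 1 - y / (x + y) := by field_simp; ring
  rw [e] at key1 key2
  linarith

lemma rpow_add_one_sub_rpow_le {a x : ℝ} (ha : 1 ≤ a) (hx : 0 ≤ x) :
    (x + 1) ^ a - x ^ a ≤ a * (x + 1) ^ (a - 1) := by
  have hx1 : 0 < x + 1 := by linarith
  have h := one_add_mul_self_le_rpow_one_add (s := -1 / (x + 1))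
    (by rw [le_div_iff₀ hx1]; linarith) ha
  rw [show 1 + -1 / (x + 1) = x / (x + 1) by field_simp; ring, Real.div_rpow hx hx1.le,
    le_div_iff₀ (by positivity)] at h
  rw [Real.rpow_sub_one hx1.ne']
  have e : (1 + a * (-1 / (x + 1))) * (x + 1) ^ a
      = (x + 1) ^ a - a * ((x + 1) ^ a / (x + 1)) := by field_simp; ring
  linarith

lemma rpow_add_one_sub_rpow_le_one {a x : ℝ} (ha0 : 0 ≤ a) (ha : a ≤ 1) (hx : 0 ≤ x) :
    (x + 1) ^ a - x ^ a ≤ 1 := by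
  have := Real.rpow_add_le_add_rpow hx zero_le_one ha0 ha
  rw [Real.one_rpow] at this
  linarith

/-- The mean value theorem for `t ↦ t ^ K - (t + y) ^ K`: the mixed difference of `t ^ K` is bounded
by the second derivative at the left end point, whose constant `K * (1 - K)` is at most `1`. -/
lemma crossDiff_rpow_ge {K u x y : ℝ} (hK0 : 0 < K) (hK1 : K ≤ 1) (hu : 0 < u) (hx : 0 ≤ x)
    (hy : 0 ≤ y) :
    -(x * y * u ^ (K - 2)) ≤ (u + x + y) ^ K - (u + x) ^ K - (u + y) ^ K + u ^ K := by
  have hd : ∀ t : ℝ, 0 < t → HasDerivAt (fun t : ℝ => t ^ K - (t + y) ^ K)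
      (K * t ^ (K - 1) - K * (t + y) ^ (K - 1)) t := fun t ht => by
    have h1 := Real.hasDerivAt_rpow_const (p := K) (Or.inl ht.ne')
    have h2 := Real.hasDerivAt_rpow_const (x := t + y) (p := K) (Or.inl (by positivity))
    exact h1.sub (h2.comp_add_const t y)
  have hbound : ∀ t : ℝ, u ≤ t → K * t ^ (K - 1) - K * (t + y) ^ (K - 1) ≤ y * u ^ (K - 2) := by
    intro t ht
    have ht0 : 0 < t := hu.trans_le ht
    have h1 : t ^ K / (t + y) ≤ (t + y) ^ (K - 1) := by
      rw [Real.rpow_sub_one (by positivity)]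
      gcongr
      linarith
    have h2 : t ^ (K - 1) - t ^ K / (t + y) ≤ y * t ^ (K - 2) := by
      rw [Real.rpow_sub_one ht0.ne', Real.rpow_sub ht0, Real.rpow_two]
      have hp : 0 < t ^ K := by positivity
      have e : t ^ K / t - t ^ K / (t + y) = y * (t ^ K / (t * (t + y))) := by
        field_simp; ring
      rw [e]
      gcongr
      nlinarith
    have h3 : t ^ (K - 2) ≤ u ^ (K - 2) :=
      Real.rpow_le_rpow_of_nonpos hu ht (by linarith)
    have h4 : t ^ (K - 1) - (t + y) ^ (K - 1) ≤ y * u ^ (K - 2) := by nlinarith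
    have h5 : 0 ≤ y * u ^ (K - 2) := by positivity
    nlinarith
  have key := (convex_Icc u (u + x)).image_sub_le_mul_sub_of_deriv_le
    (f := fun t : ℝ => t ^ K - (t + y) ^ K) (C := y * u ^ (K - 2))
    (fun t ht => (hd t (hu.trans_le ht.1)).continuousAt.continuousWithinAt)
    (fun t ht => by
      rw [interior_Icc] at ht
      exact (hd t (hu.trans ht.1)).differentiableAt.differentiableWithinAt)
    (fun t ht => by
      rw [interior_Icc] at ht
      rw [(hd t (hu.trans ht.1)).deriv]
      exact hbound t ht.1.le)
    u ⟨le_rfl, by linarith⟩ (u + x) ⟨by linarith, le_rfl⟩ (by linarith)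
  nlinarith

/-! ### The covariance matrix of the increments -/

section Covariance

variable {H K : ℝ}

lemma powSumDiff_nonpos (hH : 0 < H) (hK0 : 0 < K) (hK1 : K ≤ 1) (i j : ℕ) :
    powSumDiff H K i j ≤ 0 := by
  have hmono : ∀ k : ℕ, (k : ℝ) ^ (2 * H) ≤ ((k : ℝ) + 1) ^ (2 * H) := fun k => by
    gcongr; linarith
  have h := (Real.concaveOn_rpow hK0.le hK1).crossDiff_nonpos
    (u := (i : ℝ) ^ (2 * H) + (j : ℝ) ^ (2 * H)) (by positivity)
    (sub_nonneg.2 (hmono i)) (sub_nonneg.2 (hmono j))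
  refine le_trans (le_of_eq ?_) h
  rw [powSumDiff]
  ring_nf

/-- The mixed differences have a constant sign, so that their absolute row sums telescope. -/
lemma sum_abs_powSumDiff_le (hH : 0 < H) (hK0 : 0 < K) (hK1 : K ≤ 1) (i n : ℕ) :
    ∑ j ∈ Finset.range n, |powSumDiff H K i j|
      ≤ ((i : ℝ) + 1) ^ (2 * H * K) - (i : ℝ) ^ (2 * H * K) := by
  set D : ℕ → ℝ := fun j => (((i : ℝ) + 1) ^ (2 * H) + (j : ℝ) ^ (2 * H)) ^ K
    - ((i : ℝ) ^ (2 * H) + (j : ℝ) ^ (2 * H)) ^ K with hD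
  have h1 : ∀ j, |powSumDiff H K i j| = D j - D (j + 1) := fun j => by
    rw [abs_of_nonpos (powSumDiff_nonpos hH hK0 hK1 i j), hD, powSumDiff]
    push_cast
    ring
  simp_rw [h1]
  rw [Finset.sum_range_sub']
  have h2 : 0 ≤ D n := by
    rw [hD, sub_nonneg]
    gcongr
    linarith
  have h3 : D 0 = ((i : ℝ) + 1) ^ (2 * H * K) - (i : ℝ) ^ (2 * H * K) := by
    rw [hD]
    simp only [Nat.cast_zero, Real.zero_rpow (mul_pos two_pos hH).ne', add_zero]
    rw [Real.rpow_mul (by positivity) (2 * H) K, Real.rpow_mul (by positivity) (2 * H) K]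
  linarith

lemma absPowDiff_comm (a : ℝ) (i j : ℕ) : absPowDiff a i j = absPowDiff a j i := by
  have e1 : |(i : ℝ) - j + 1| = |(j : ℝ) - i - 1| := by rw [← abs_neg]; ring_nf
  have e2 : |(i : ℝ) - j - 1| = |(j : ℝ) - i + 1| := by rw [← abs_neg]; ring_nf
  rw [absPowDiff, absPowDiff, e1, e2, abs_sub_comm (i : ℝ)]
  ring

lemma absPowDiff_self {a : ℝ} (ha : 0 < a) (i : ℕ) : absPowDiff a i i = 2 := by
  simp [absPowDiff, Real.zero_rpow ha.ne']
  norm_num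

lemma absPowDiff_of_lt (a : ℝ) {i j : ℕ} (h : j < i) :
    absPowDiff a i j = ((i : ℝ) - j + 1) ^ a + ((i : ℝ) - j - 1) ^ a - 2 * ((i : ℝ) - j) ^ a := by
  have h' : (j : ℝ) + 1 ≤ i := by exact_mod_cast h
  rw [absPowDiff, abs_of_nonneg (by linarith), abs_of_nonneg (by linarith),
    abs_of_nonneg (by linarith)]

lemma absPowDiff_nonpos {a : ℝ} (ha0 : 0 < a) (ha1 : a ≤ 1) {i j : ℕ} (h : i ≠ j) :
    absPowDiff a i j ≤ 0 := by
  wlog hij : j < i generalizing i j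
  · rw [absPowDiff_comm]
    exact this h.symm (by omega)
  have h' : (j : ℝ) + 1 ≤ i := by exact_mod_cast hij
  rw [absPowDiff_of_lt a hij]
  have := (Real.concaveOn_rpow ha0.le ha1).crossDiff_nonpos (u := (i : ℝ) - j - 1)
    (by linarith) zero_le_one zero_le_one
  ring_nf at this ⊢
  linarith

lemma absPowDiff_nonneg {a : ℝ} (ha1 : 1 ≤ a) (i j : ℕ) : 0 ≤ absPowDiff a i j := by
  rcases eq_or_ne i j with rfl | h
  · rw [absPowDiff_self (by linarith)]; norm_num
  wlog hij : j < i generalizing i j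
  · rw [absPowDiff_comm]
    exact this j i h.symm (by omega)
  have h' : (j : ℝ) + 1 ≤ i := by exact_mod_cast hij
  rw [absPowDiff_of_lt a hij]
  have := (convexOn_rpow ha1).neg.crossDiff_nonpos (u := (i : ℝ) - j - 1)
    (by linarith) zero_le_one zero_le_one
  simp only [Pi.neg_apply] at this
  ring_nf at this ⊢
  linarith

lemma sum_absPowDiff (a : ℝ) {i n : ℕ} (hi : i < n) :
    ∑ j ∈ Finset.range n, absPowDiff a i j
      = (((n : ℝ) - i) ^ a - ((n : ℝ) - i - 1) ^ a) + (((i : ℝ) + 1) ^ a - (i : ℝ) ^ a) := by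
  set T : ℕ → ℝ := fun j => |(i : ℝ) - j| ^ a - |(i : ℝ) - j + 1| ^ a with hT
  have h1 : ∀ j, absPowDiff a i j = T (j + 1) - T j := fun j => by
    rw [hT, absPowDiff]
    push_cast
    rw [show (i : ℝ) - (j + 1) = i - j - 1 by ring, show (i : ℝ) - j - 1 + 1 = i - j by ring]
    ring
  have hi' : (i : ℝ) + 1 ≤ n := by exact_mod_cast hi
  simp_rw [h1]
  rw [Finset.sum_range_sub, hT]
  simp only [Nat.cast_zero, sub_zero]
  rw [abs_of_nonpos (by linarith), abs_of_nonpos (by linarith), abs_of_nonneg (by positivity),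
    abs_of_nonneg (by positivity)]
  ring_nf

lemma sum_abs_absPowDiff_le_four {a : ℝ} (ha0 : 0 < a) (ha1 : a ≤ 1) {i n : ℕ} (hi : i < n) :
    ∑ j ∈ Finset.range n, |absPowDiff a i j| ≤ 4 := by
  have h1 : ∀ j, |absPowDiff a i j| = (if i = j then 4 else 0) - absPowDiff a i j := fun j => by
    split_ifs with h
    · rw [← h, absPowDiff_self ha0]; norm_num
    · rw [abs_of_nonpos (absPowDiff_nonpos ha0 ha1 h)]; ring
  have hi' : (i : ℝ) + 1 ≤ n := by exact_mod_cast hi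
  simp_rw [h1]
  rw [Finset.sum_sub_distrib, sum_absPowDiff a hi, Finset.sum_ite_eq,
    if_pos (Finset.mem_range.2 hi)]
  have h2 : ((n : ℝ) - i - 1) ^ a ≤ ((n : ℝ) - i) ^ a :=
    Real.rpow_le_rpow (by linarith) (by linarith) ha0.le
  have h3 : (i : ℝ) ^ a ≤ ((i : ℝ) + 1) ^ a :=
    Real.rpow_le_rpow (by positivity) (by linarith) ha0.le
  linarith

lemma rpow_succ_sub_rpow_le_rpow_of_lt {a : ℝ} (ha1 : 1 ≤ a) {i n : ℕ} (hi : i < n) :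
    ((i : ℝ) + 1) ^ a - (i : ℝ) ^ a ≤ a * (n : ℝ) ^ (a - 1) := by
  have hi' : (i : ℝ) + 1 ≤ n := by exact_mod_cast hi
  refine (rpow_add_one_sub_rpow_le ha1 (by positivity)).trans ?_
  gcongr

lemma sum_abs_absPowDiff_le_rpow {a : ℝ} (ha1 : 1 ≤ a) {i n : ℕ} (hi : i < n) :
    ∑ j ∈ Finset.range n, |absPowDiff a i j| ≤ 2 * a * (n : ℝ) ^ (a - 1) := by
  simp_rw [fun j => abs_of_nonneg (absPowDiff_nonneg ha1 i j)]
  rw [sum_absPowDiff a hi]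
  have h1 := rpow_succ_sub_rpow_le_rpow_of_lt ha1 hi
  have h2 := rpow_succ_sub_rpow_le_rpow_of_lt ha1 (i := n - i - 1) (n := n) (by omega)
  have e : ((n - i - 1 : ℕ) : ℝ) = (n : ℝ) - i - 1 := by
    rw [Nat.cast_sub (by omega), Nat.cast_sub hi.le, Nat.cast_one]
  rw [e, sub_add_cancel] at h2
  linarith

/-- Uniform decay of the mixed differences away from the origin. With `M = max i j`, each of the two
increments of `x ^ (2 * H)` is at most `4 * M ^ (2 * H - 1)`, and the second derivative of `x ^ K` is
evaluated at a point of size at least `M ^ (2 * H)`; the resulting exponent `2 * H * K - 2` of `M` is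
at most `-1/2`. -/
lemma abs_powSumDiff_le (hH : 1 ≤ 2 * H) (hH1 : H < 1) (hK0 : 0 < K) (hK1 : K ≤ 1)
    (hHK : H * K ≤ 3 / 4) {i : ℕ} (hi : 1 ≤ i) (j : ℕ) :
    |powSumDiff H K i j| ≤ 16 * (i : ℝ) ^ (-(1 / 2) : ℝ) := by
  set h := 2 * H with hh
  set M : ℝ := max (i : ℝ) j with hM
  have hi1 : (1 : ℝ) ≤ i := by exact_mod_cast hi
  have hiM : (i : ℝ) ≤ M := le_max_left _ _
  have hjM : (j : ℝ) ≤ M := le_max_right _ _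
  have hM1 : 1 ≤ M := hi1.trans hiM
  have hM0 : 0 < M := by linarith
  have hincr : ∀ k : ℕ, (k : ℝ) ≤ M →
      0 ≤ ((k : ℝ) + 1) ^ h - (k : ℝ) ^ h ∧ ((k : ℝ) + 1) ^ h - (k : ℝ) ^ h ≤ 4 * M ^ (h - 1) := by
    intro k hk
    constructor
    · rw [sub_nonneg]; gcongr; linarith
    · refine (rpow_add_one_sub_rpow_le hH (by positivity)).trans ?_
      have h1 : ((k : ℝ) + 1) ^ (h - 1) ≤ (2 * M) ^ (h - 1) := by gcongr; linarith
      have h2 : (2 : ℝ) ^ (h - 1) ≤ 2 := by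
        calc (2 : ℝ) ^ (h - 1) ≤ 2 ^ (1 : ℝ) :=
              Real.rpow_le_rpow_of_exponent_le one_le_two (by linarith)
          _ = 2 := Real.rpow_one 2
      rw [Real.mul_rpow two_pos.le hM0.le] at h1
      have h3 : 0 < M ^ (h - 1) := by positivity
      have h4 : ((k : ℝ) + 1) ^ (h - 1) ≤ 2 * M ^ (h - 1) := h1.trans (by gcongr)
      calc h * ((k : ℝ) + 1) ^ (h - 1) ≤ 2 * (2 * M ^ (h - 1)) := by
            gcongr; linarith
        _ = _ := by ring
  obtain ⟨hx0, hx1⟩ := hincr i hiM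
  obtain ⟨hy0, hy1⟩ := hincr j hjM
  have hMu : M ^ h ≤ (i : ℝ) ^ h + (j : ℝ) ^ h := by
    have h1 : 0 ≤ (i : ℝ) ^ h := by positivity
    have h2 : 0 ≤ (j : ℝ) ^ h := by positivity
    rcases max_choice (i : ℝ) j with e | e <;> rw [hM, e] <;> linarith
  have hu : 0 < (i : ℝ) ^ h + (j : ℝ) ^ h := by positivity
  have key := crossDiff_rpow_ge hK0 hK1 hu hx0 hy0
  have e : powSumDiff H K i j = ((i : ℝ) ^ h + (j : ℝ) ^ h + (((i : ℝ) + 1) ^ h - (i : ℝ) ^ h)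
      + (((j : ℝ) + 1) ^ h - (j : ℝ) ^ h)) ^ K
      - ((i : ℝ) ^ h + (j : ℝ) ^ h + (((i : ℝ) + 1) ^ h - (i : ℝ) ^ h)) ^ K
      - ((i : ℝ) ^ h + (j : ℝ) ^ h + (((j : ℝ) + 1) ^ h - (j : ℝ) ^ h)) ^ K
      + ((i : ℝ) ^ h + (j : ℝ) ^ h) ^ K := by
    rw [powSumDiff, ← hh]; ring_nf
  rw [abs_of_nonpos (powSumDiff_nonpos (by linarith) hK0 hK1 i j), e]
  have hpow : ((i : ℝ) ^ h + (j : ℝ) ^ h) ^ (K - 2) ≤ M ^ (h * (K - 2)) := by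
    rw [Real.rpow_mul hM0.le]
    exact Real.rpow_le_rpow_of_nonpos (by positivity) hMu (by linarith)
  have hM2 : M ^ (h - 1) * M ^ (h - 1) * M ^ (h * (K - 2)) ≤ (i : ℝ) ^ (-(1 / 2) : ℝ) := by
    rw [← Real.rpow_add hM0, ← Real.rpow_add hM0]
    calc M ^ (h - 1 + (h - 1) + h * (K - 2)) ≤ M ^ (-(1 / 2) : ℝ) :=
          Real.rpow_le_rpow_of_exponent_le hM1 (by rw [hh]; nlinarith)
      _ ≤ _ := Real.rpow_le_rpow_of_nonpos (by linarith) hiM (by norm_num)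
  have hfin : (((i : ℝ) + 1) ^ h - (i : ℝ) ^ h) * (((j : ℝ) + 1) ^ h - (j : ℝ) ^ h)
      * ((i : ℝ) ^ h + (j : ℝ) ^ h) ^ (K - 2)
      ≤ (4 * M ^ (h - 1)) * (4 * M ^ (h - 1)) * M ^ (h * (K - 2)) := by gcongr
  linarith

/-- The variances of the increments are bounded below, far away from the origin. -/
lemma one_le_powSumDiff_add_absPowDiff_self (hH0 : 0 < H) (hH1 : H < 1) (hK0 : 0 < K) (hK1 : K ≤ 1)
    (hHK : H * K ≤ 3 / 4) {i : ℕ} (hi : 256 ≤ i) :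
    1 ≤ powSumDiff H K i i + absPowDiff (2 * H * K) i i := by
  rw [absPowDiff_self (by positivity)]
  -- for `2 * H * K ≤ 1` the row sum bound suffices; otherwise `2 * H ≥ 1`, and the threshold `256`
  -- makes the bound `16 * i ^ (-1/2)` at most `1`
  suffices h : |powSumDiff H K i i| ≤ 1 by linarith [neg_abs_le (powSumDiff H K i i)]
  rcases le_total (2 * H * K) 1 with ha | ha
  · calc |powSumDiff H K i i| ≤ ∑ j ∈ Finset.range (i + 1), |powSumDiff H K i j| :=
          Finset.single_le_sum (f := fun j => |powSumDiff H K i j|) (fun _ _ => abs_nonneg _)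
            (Finset.self_mem_range_succ i)
      _ ≤ _ := sum_abs_powSumDiff_le hH0 hK0 hK1 i _
      _ ≤ 1 := rpow_add_one_sub_rpow_le_one (by positivity) ha (by positivity)
  · refine (abs_powSumDiff_le (by nlinarith) hH1 hK0 hK1 hHK (by omega) i).trans ?_
    have hi' : (256 : ℝ) ≤ i := by exact_mod_cast hi
    have h1 : (i : ℝ) ^ (-(1 / 2) : ℝ) ≤ 256 ^ (-(1 / 2) : ℝ) :=
      Real.rpow_le_rpow_of_nonpos (by norm_num) hi' (by norm_num)
    have h2 : (256 : ℝ) ^ (-(1 / 2) : ℝ) = 1 / 16 := by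
      rw [show (256 : ℝ) = 16 ^ (2 : ℝ) by norm_num, ← Real.rpow_mul (by norm_num)]
      norm_num [Real.rpow_neg]
    linarith

/-- The squared Frobenius norm is at least of order `n`, from the diagonal entries alone. -/
lemma half_le_sum_sq (hH0 : 0 < H) (hH1 : H < 1) (hK0 : 0 < K) (hK1 : K ≤ 1)
    (hHK : H * K ≤ 3 / 4) {n : ℕ} (hn : 512 ≤ n) :
    (n : ℝ) / 2 ≤ ∑ i ∈ Finset.range n, ∑ j ∈ Finset.range n,
      (powSumDiff H K i j + absPowDiff (2 * H * K) i j) ^ 2 := by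
  have h1 : ∀ i ∈ Finset.range n, (if 256 ≤ i then (1 : ℝ) else 0) ≤ ∑ j ∈ Finset.range n,
      (powSumDiff H K i j + absPowDiff (2 * H * K) i j) ^ 2 := fun i hi => by
    split_ifs with h
    · have h2 := one_le_powSumDiff_add_absPowDiff_self hH0 hH1 hK0 hK1 hHK h
      calc (1 : ℝ) ≤ (powSumDiff H K i i + absPowDiff (2 * H * K) i i) ^ 2 := one_le_pow₀ h2
        _ ≤ _ := Finset.single_le_sum
          (f := fun j => (powSumDiff H K i j + absPowDiff (2 * H * K) i j) ^ 2)
          (fun _ _ => sq_nonneg _) hi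
    · exact Finset.sum_nonneg fun _ _ => sq_nonneg _
  refine le_trans ?_ (Finset.sum_le_sum h1)
  have hn' : (512 : ℝ) ≤ n := by exact_mod_cast hn
  have hf : (Finset.range n).filter (fun i => 256 ≤ i) = Finset.Ico 256 n := by
    ext i; simp [and_comm]
  rw [Finset.sum_ite, hf]
  simp only [Finset.sum_const, Nat.card_Ico, nsmul_eq_mul, mul_one, mul_zero, add_zero]
  rw [Nat.cast_sub (by omega)]
  push_cast
  linarith

lemma sum_abs_le_five (hH0 : 0 < H) (hK0 : 0 < K) (hK1 : K ≤ 1)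
    (ha : 2 * H * K ≤ 1) {i n : ℕ} (hi : i < n) :
    ∑ j ∈ Finset.range n, |powSumDiff H K i j + absPowDiff (2 * H * K) i j| ≤ 5 := by
  have h1 := sum_abs_powSumDiff_le hH0 hK0 hK1 i n
  have h2 := rpow_add_one_sub_rpow_le_one (a := 2 * H * K) (by positivity) ha (Nat.cast_nonneg i)
  have h3 := sum_abs_absPowDiff_le_four (a := 2 * H * K) (by positivity) ha hi
  refine (Finset.sum_le_sum fun j _ => abs_add_le _ _).trans ?_
  rw [Finset.sum_add_distrib]
  linarith

lemma sum_abs_le_rpow (hH0 : 0 < H) (hK0 : 0 < K) (hK1 : K ≤ 1)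
    (ha : 1 ≤ 2 * H * K) {i n : ℕ} (hi : i < n) :
    ∑ j ∈ Finset.range n, |powSumDiff H K i j + absPowDiff (2 * H * K) i j|
      ≤ 3 * (2 * H * K) * (n : ℝ) ^ (2 * H * K - 1) := by
  have h1 := sum_abs_powSumDiff_le hH0 hK0 hK1 i n
  have h2 := rpow_succ_sub_rpow_le_rpow_of_lt ha hi
  have h3 := sum_abs_absPowDiff_le_rpow ha hi
  refine (Finset.sum_le_sum fun j _ => abs_add_le _ _).trans ?_
  rw [Finset.sum_add_distrib]
  linarith

/-! ### The critical exponent -/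

/-- The mean value theorem for `t ↦ (t + 1) ^ (3/2) - t ^ (3/2)`, whose derivative is
`(3/2) * (√(t + 1) - √t) ≥ (3/4) / √(t + 1)`. -/
lemma absPowDiff_three_halves_ge {i j : ℕ} (h : j < i) :
    3 / 4 / √((i : ℝ) - j + 1) ≤ absPowDiff (3 / 2) i j := by
  have h' : (j : ℝ) + 1 ≤ i := by exact_mod_cast h
  rw [absPowDiff_of_lt _ h]
  set x : ℝ := (i : ℝ) - j with hx
  have hx1 : 1 ≤ x := by linarith
  have hd : ∀ t : ℝ, HasDerivAt (fun t : ℝ => (t + 1) ^ (3 / 2 : ℝ) - t ^ (3 / 2 : ℝ))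
      (3 / 2 * √(t + 1) - 3 / 2 * √t) t := fun t => by
    have h1 := Real.hasDerivAt_rpow_const (x := t) (p := 3 / 2) (Or.inr (by norm_num))
    have h2 := Real.hasDerivAt_rpow_const (x := t + 1) (p := 3 / 2) (Or.inr (by norm_num))
    refine ((h2.comp t ((hasDerivAt_id t).add_const 1)).sub h1).congr_deriv ?_
    rw [Real.sqrt_eq_rpow, Real.sqrt_eq_rpow]
    norm_num
  have key := (convex_Icc (x - 1) x).mul_sub_le_image_sub_of_le_deriv
    (f := fun t : ℝ => (t + 1) ^ (3 / 2 : ℝ) - t ^ (3 / 2 : ℝ)) (C := 3 / 4 / √(x + 1))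
    (fun t _ => (hd t).continuousAt.continuousWithinAt)
    (fun t _ => (hd t).differentiableAt.differentiableWithinAt)
    (fun t ht => by
      rw [interior_Icc] at ht
      obtain ⟨ht1, ht2⟩ := ht
      rw [(hd t).deriv, div_le_iff₀ (Real.sqrt_pos.2 (by linarith))]
      have hs1 := Real.sq_sqrt (show 0 ≤ t by linarith)
      have hs2 := Real.sq_sqrt (show 0 ≤ t + 1 by linarith)
      have hle : √(t + 1) ≤ √(x + 1) := Real.sqrt_le_sqrt (by linarith)
      have hle2 : √t ≤ √(t + 1) := Real.sqrt_le_sqrt (by linarith)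
      have := Real.sqrt_nonneg t
      nlinarith)
    (x - 1) ⟨le_rfl, by linarith⟩ x ⟨by linarith, le_rfl⟩ (by linarith)
  rw [show x - 1 + 1 = x by ring] at key
  linarith

lemma sum_one_div_ge (i : ℕ) :
    Real.log ((i : ℝ) + 1) - 1 ≤ ∑ j ∈ Finset.range i, 1 / ((i : ℝ) - j + 1) := by
  have h1 := log_add_one_le_harmonic (i + 1)
  have h2 : ((harmonic (i + 1) : ℚ) : ℝ) = 1 + ∑ j ∈ Finset.range i, 1 / ((j : ℝ) + 2) := by
    rw [harmonic, Finset.sum_range_succ']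
    push_cast
    rw [add_comm]
    congr 1
    · norm_num
    · exact Finset.sum_congr rfl fun j _ => by rw [one_div]; ring_nf
  have h3 : ∑ j ∈ Finset.range i, 1 / ((i : ℝ) - j + 1) = ∑ j ∈ Finset.range i, 1 / ((j : ℝ) + 2) := by
    rw [← Finset.sum_range_reflect]
    refine Finset.sum_congr rfl fun j hj => ?_
    have hj' := Finset.mem_range.1 hj
    rw [Nat.sub_sub, Nat.cast_sub (by omega)]
    push_cast
    ring_nf
  have h4 : Real.log ((i : ℝ) + 1) ≤ Real.log ((i + 1 + 1 : ℕ) : ℝ) := by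
    apply Real.log_le_log (by positivity)
    push_cast
    linarith
  rw [h3]
  linarith

lemma sum_log_ge {n : ℕ} (hn : n ≠ 0) :
    n * Real.log n - n ≤ ∑ i ∈ Finset.range n, Real.log ((i : ℝ) + 1) := by
  have h1 := Stirling.le_log_factorial_stirling hn
  have h2 : ∑ i ∈ Finset.range n, Real.log ((i : ℝ) + 1) = Real.log (n.factorial : ℝ) := by
    rw [← Finset.prod_range_add_one_eq_factorial, Nat.cast_prod, Real.log_prod]
    · simp
    · intro i _; positivity
  have h3 : 0 ≤ Real.log n := Real.log_natCast_nonneg n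
  have h4 : 0 ≤ Real.log (2 * Real.pi) := Real.log_nonneg (by nlinarith [Real.pi_gt_three])
  rw [h2]
  linarith

/-- At the critical exponent the squared Frobenius norm of the stationary part of the covariance
grows like `n * log n`. -/
lemma sum_sq_absPowDiff_three_halves_ge {n : ℕ} (hn : n ≠ 0) :
    9 / 16 * (n * Real.log n - 2 * n)
      ≤ ∑ i ∈ Finset.range n, ∑ j ∈ Finset.range n, absPowDiff (3 / 2) i j ^ 2 := by
  calc 9 / 16 * (n * Real.log n - 2 * n)
      ≤ 9 / 16 * ∑ i ∈ Finset.range n, (Real.log ((i : ℝ) + 1) - 1) := by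
        have := sum_log_ge hn
        rw [Finset.sum_sub_distrib]
        simp only [Finset.sum_const, Finset.card_range, nsmul_eq_mul, mul_one]
        linarith
    _ ≤ 9 / 16 * ∑ i ∈ Finset.range n, ∑ j ∈ Finset.range i, 1 / ((i : ℝ) - j + 1) := by
        gcongr with i _
        exact sum_one_div_ge i
    _ ≤ _ := by
        rw [Finset.mul_sum]
        refine Finset.sum_le_sum fun i hi => ?_
        rw [Finset.mul_sum]
        refine le_trans (Finset.sum_le_sum fun j hj => ?_)
          (Finset.sum_le_sum_of_subset_of_nonneg
            (Finset.range_subset_range.2 (Finset.mem_range.1 hi).le) fun _ _ _ => sq_nonneg _)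
        have hj' := Finset.mem_range.1 hj
        have h' : (j : ℝ) + 1 ≤ i := by exact_mod_cast hj'
        have h1 := absPowDiff_three_halves_ge hj'
        have hpos : 0 < (i : ℝ) - j + 1 := by linarith
        calc 9 / 16 * (1 / ((i : ℝ) - j + 1)) = (3 / 4 / √((i : ℝ) - j + 1)) ^ 2 := by
              rw [div_pow, Real.sq_sqrt hpos.le]; ring
          _ ≤ _ := by gcongr

/-- At the critical exponent the non-stationary part of the covariance has squared Frobenius norm
of order `n`: each row is bounded by the product of its supremum and its absolute sum. -/
lemma sum_sq_powSumDiff_le (hH0 : 0 < H) (hH1 : H < 1) (hK0 : 0 < K) (hK1 : K ≤ 1)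
    (hHK : H * K = 3 / 4) (n : ℕ) :
    ∑ i ∈ Finset.range n, ∑ j ∈ Finset.range n, powSumDiff H K i j ^ 2 ≤ 48 * n := by
  have ha : 2 * H * K = 3 / 2 := by linarith
  have hrow : ∀ i : ℕ, ∑ j ∈ Finset.range n, powSumDiff H K i j ^ 2 ≤ 48 := fun i => by
    have h1 := sum_abs_powSumDiff_le hH0 hK0 hK1 i n
    rw [ha] at h1
    rcases Nat.eq_zero_or_pos i with rfl | hi
    · norm_num [Real.zero_rpow] at h1
      calc ∑ j ∈ Finset.range n, powSumDiff H K 0 j ^ 2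
          ≤ ∑ j ∈ Finset.range n, |powSumDiff H K 0 j| := by
            refine Finset.sum_le_sum fun j hj => ?_
            have : |powSumDiff H K 0 j| ≤ 1 := (Finset.single_le_sum
              (f := fun j => |powSumDiff H K 0 j|) (fun _ _ => abs_nonneg _) hj).trans h1
            rw [← sq_abs]
            nlinarith [abs_nonneg (powSumDiff H K 0 j)]
        _ ≤ 48 := h1.trans (by norm_num)
    · have hi1 : (1 : ℝ) ≤ i := by exact_mod_cast hi
      have h2 : ((i : ℝ) + 1) ^ (3 / 2 : ℝ) - (i : ℝ) ^ (3 / 2 : ℝ) ≤ 3 * (i : ℝ) ^ (1 / 2 : ℝ) := by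
        refine (rpow_add_one_sub_rpow_le (by norm_num) (by positivity)).trans ?_
        calc 3 / 2 * ((i : ℝ) + 1) ^ (3 / 2 - 1 : ℝ) ≤ 3 / 2 * (4 * (i : ℝ)) ^ (3 / 2 - 1 : ℝ) := by
              gcongr
              linarith
          _ = 3 * (i : ℝ) ^ (1 / 2 : ℝ) := by
              rw [Real.mul_rpow (by norm_num) (by positivity),
                show (4 : ℝ) = 2 ^ (2 : ℝ) by norm_num, ← Real.rpow_mul (by norm_num)]
              norm_num
              ring
      calc ∑ j ∈ Finset.range n, powSumDiff H K i j ^ 2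
          ≤ ∑ j ∈ Finset.range n, 16 * (i : ℝ) ^ (-(1 / 2) : ℝ) * |powSumDiff H K i j| := by
            refine Finset.sum_le_sum fun j _ => ?_
            rw [← sq_abs, sq]
            exact mul_le_mul_of_nonneg_right
              (abs_powSumDiff_le (by nlinarith) hH1 hK0 hK1 hHK.le hi j) (abs_nonneg _)
        _ = 16 * (i : ℝ) ^ (-(1 / 2) : ℝ) * ∑ j ∈ Finset.range n, |powSumDiff H K i j| := by
            rw [Finset.mul_sum]
        _ ≤ 16 * (i : ℝ) ^ (-(1 / 2) : ℝ) * (3 * (i : ℝ) ^ (1 / 2 : ℝ)) := by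
            gcongr
            exact h1.trans h2
        _ = 48 * ((i : ℝ) ^ (-(1 / 2) : ℝ) * (i : ℝ) ^ (1 / 2 : ℝ)) := by ring
        _ = 48 := by rw [← Real.rpow_add (by linarith)]; norm_num
  calc _ ≤ ∑ _i ∈ Finset.range n, (48 : ℝ) := Finset.sum_le_sum fun i _ => hrow i
    _ = 48 * n := by simp [mul_comm]

lemma mul_log_le_sum_sq (hH0 : 0 < H) (hH1 : H < 1) (hK0 : 0 < K) (hK1 : K ≤ 1)
    (hHK : H * K = 3 / 4) {n : ℕ} (hn : n ≠ 0) (hlog : 400 ≤ Real.log n) :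
    9 / 64 * (n * Real.log n) ≤ ∑ i ∈ Finset.range n, ∑ j ∈ Finset.range n,
      (powSumDiff H K i j + absPowDiff (2 * H * K) i j) ^ 2 := by
  have ha : 2 * H * K = 3 / 2 := by linarith
  rw [ha]
  have h1 := sum_sq_absPowDiff_three_halves_ge hn
  have h2 := sum_sq_powSumDiff_le hH0 hH1 hK0 hK1 hHK n
  have h3 : ∑ i ∈ Finset.range n, ∑ j ∈ Finset.range n, (1 / 2 * absPowDiff (3 / 2) i j ^ 2
      - powSumDiff H K i j ^ 2) ≤ ∑ i ∈ Finset.range n, ∑ j ∈ Finset.range n,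
      (powSumDiff H K i j + absPowDiff (3 / 2) i j) ^ 2 :=
    Finset.sum_le_sum fun i _ => Finset.sum_le_sum fun j _ => by
      nlinarith [sq_nonneg (absPowDiff (3 / 2) i j + 2 * powSumDiff H K i j)]
  simp_rw [Finset.sum_sub_distrib, ← Finset.mul_sum] at h3
  have hn0 : (0 : ℝ) ≤ n := Nat.cast_nonneg n
  nlinarith

end Covariance

/-! ### The rates of convergence -/

namespace IsBifractionalBM

variable {Ω Ω' : Type*} [MeasurableSpace Ω] [MeasurableSpace Ω'] {P : Measure Ω} {Q : Measure Ω'}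
  {H K : ℝ} {B : ℝ≥0 → Ω → ℝ} {N : Ω' → ℝ}

/-- The bound of `kolmogorovDist_normQuadVar_le` after removing the common factor `2 ^ (-K)` of the
covariances, which cancels. -/
lemma kolmogorovDist_normQuadVar_le_div_sqrt (hB : IsBifractionalBM H K B P)
    (hN : HasLaw N (gaussianReal 0 1) Q) {n : ℕ} (hn : n ≠ 0) {L S : ℝ}
    (hL : ∀ i < n, ∑ j ∈ Finset.range n, |powSumDiff H K i j + absPowDiff (2 * H * K) i j| ≤ L)
    (hS : 0 < S) (hSle : S ≤ ∑ i ∈ Finset.range n, ∑ j ∈ Finset.range n,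
      (powSumDiff H K i j + absPowDiff (2 * H * K) i j) ^ 2) :
    kolmogorovDist (normQuadVar H K B P n) P N Q ≤ 4 * L / √(2 * S) := by
  set q : ℝ := 1 / 2 ^ K with hq
  have hq0 : 0 < q := by positivity
  have hL0 : 0 ≤ L := (Finset.sum_nonneg fun _ _ => abs_nonneg _).trans (hL 0 (by omega))
  have hsq : ∑ i ∈ Finset.range n, ∑ j ∈ Finset.range n, bifIncrCov H K i j ^ 2
      = q ^ 2 * ∑ i ∈ Finset.range n, ∑ j ∈ Finset.range n,
        (powSumDiff H K i j + absPowDiff (2 * H * K) i j) ^ 2 := by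
    simp_rw [Finset.mul_sum, bifIncrCov, mul_pow, ← hq]
  refine (hB.kolmogorovDist_normQuadVar_le hN hn (L := q * L) (fun i hi => ?_) (by positivity)
    ?_).trans ?_
  · simp_rw [bifIncrCov, abs_mul, ← Finset.mul_sum, ← hq, abs_of_pos hq0]
    exact mul_le_mul_of_nonneg_left (hL i hi) hq0.le
  · rw [hsq]
    have := hS.trans_le hSle
    positivity
  · rw [hsq, show ∀ x : ℝ, 2 * (q ^ 2 * x) = q ^ 2 * (2 * x) by intro x; ring,
      Real.sqrt_mul (by positivity), Real.sqrt_sq hq0.le,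
      show 4 * (q * L) = q * (4 * L) by ring, mul_div_mul_left _ _ hq0.ne']
    gcongr

variable [IsProbabilityMeasure P] [IsProbabilityMeasure Q]

/-- The rate for `H * K ≤ 1/2`. The constant `34` exceeds `√512`, so that the trivial bound `1`
suffices for `n < 512`. -/
lemma kolmogorovDist_le_of_mul_le_half (hB : IsBifractionalBM H K B P)
    (hN : HasLaw N (gaussianReal 0 1) Q) (hH0 : 0 < H) (hH1 : H < 1) (hK0 : 0 < K) (hK1 : K ≤ 1)
    (hHK : H * K ≤ 1 / 2) {n : ℕ} (hn : 1 ≤ n) :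
    kolmogorovDist (normQuadVar H K B P n) P N Q ≤ 34 * (1 / √(n : ℝ)) := by
  have hn1 : (1 : ℝ) ≤ n := by exact_mod_cast hn
  have hs : 0 < √(n : ℝ) := Real.sqrt_pos.2 (by linarith)
  rcases lt_or_ge n 512 with h | h
  · have h' : (n : ℝ) ≤ 512 := by exact_mod_cast h.le
    refine (kolmogorovDist_le_one _ _).trans ?_
    rw [mul_one_div, le_div_iff₀ hs, one_mul]
    exact Real.sqrt_le_iff.2 ⟨by norm_num, by linarith⟩
  · refine (hB.kolmogorovDist_normQuadVar_le_div_sqrt hN (by omega)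
      (fun i hi => sum_abs_le_five hH0 hK0 hK1 (by linarith) hi) (by positivity)
      (half_le_sum_sq hH0 hH1 hK0 hK1 (by linarith) h)).trans ?_
    rw [mul_div_cancel₀ _ two_ne_zero, mul_one_div]
    gcongr
    norm_num

lemma kolmogorovDist_le_of_half_le_mul (hB : IsBifractionalBM H K B P)
    (hN : HasLaw N (gaussianReal 0 1) Q) (hH0 : 0 < H) (hH1 : H < 1) (hK0 : 0 < K) (hK1 : K ≤ 1)
    (hHK : 1 / 2 ≤ H * K) (hHK' : H * K ≤ 3 / 4) {n : ℕ} (hn : 1 ≤ n) :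
    kolmogorovDist (normQuadVar H K B P n) P N Q ≤ 34 * (n : ℝ) ^ (2 * H * K - 3 / 2) := by
  have hn1 : (1 : ℝ) ≤ n := by exact_mod_cast hn
  have hn0 : (0 : ℝ) < n := by linarith
  have hs : 0 < √(n : ℝ) := Real.sqrt_pos.2 hn0
  rcases lt_or_ge n 512 with h | h
  · have h' : (n : ℝ) ≤ 512 := by exact_mod_cast h.le
    refine (kolmogorovDist_le_one _ _).trans ?_
    have h1 : (n : ℝ) ^ (-(1 / 2) : ℝ) ≤ (n : ℝ) ^ (2 * H * K - 3 / 2) :=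
      Real.rpow_le_rpow_of_exponent_le hn1 (by linarith)
    rw [Real.rpow_neg hn0.le, ← Real.sqrt_eq_rpow] at h1
    have h2 : 1 ≤ 34 * (√(n : ℝ))⁻¹ := by
      rw [← div_eq_mul_inv, le_div_iff₀ hs, one_mul]
      exact Real.sqrt_le_iff.2 ⟨by norm_num, by linarith⟩
    linarith
  · refine (hB.kolmogorovDist_normQuadVar_le_div_sqrt hN (by omega)
      (fun i hi => sum_abs_le_rpow hH0 hK0 hK1 (by linarith) hi) (by positivity)
      (half_le_sum_sq hH0 hH1 hK0 hK1 hHK' h)).trans ?_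
    rw [mul_div_cancel₀ _ two_ne_zero, div_le_iff₀ hs, Real.sqrt_eq_rpow, mul_assoc 34,
      ← Real.rpow_add hn0, show 2 * H * K - 3 / 2 + 1 / 2 = 2 * H * K - 1 by ring, ← mul_assoc]
    gcongr
    linarith

lemma kolmogorovDist_le_of_mul_eq (hB : IsBifractionalBM H K B P)
    (hN : HasLaw N (gaussianReal 0 1) Q) (hH0 : 0 < H) (hH1 : H < 1) (hK0 : 0 < K) (hK1 : K ≤ 1)
    (hHK : H * K = 3 / 4) {n : ℕ} (hn : 2 ≤ n) :
    kolmogorovDist (normQuadVar H K B P n) P N Q ≤ 34 * (1 / √(Real.log (n : ℝ))) := by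
  have hn2 : (2 : ℝ) ≤ n := by exact_mod_cast hn
  have hn0 : (0 : ℝ) < n := by linarith
  have hlog : 0 < Real.log n := Real.log_pos (by linarith)
  have hs : 0 < √(Real.log n) := Real.sqrt_pos.2 hlog
  rw [mul_one_div]
  -- the trivial bound `1` suffices as long as `√(log n) ≤ 20`
  rcases lt_or_ge (Real.log n) 400 with h | h
  · refine (kolmogorovDist_le_one _ _).trans ?_
    rw [le_div_iff₀ hs, one_mul]
    exact Real.sqrt_le_iff.2 ⟨by norm_num, by linarith⟩
  · have ha : 2 * H * K = 3 / 2 := by linarith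
    refine (hB.kolmogorovDist_normQuadVar_le_div_sqrt hN (by omega)
      (fun i hi => sum_abs_le_rpow hH0 hK0 hK1 (by linarith) hi) (by positivity)
      (mul_log_le_sum_sq hH0 hH1 hK0 hK1 hHK (by omega) h)).trans ?_
    have e : √(2 * (9 / 64 * (n * Real.log n))) = √(9 / 32) * (√n * √(Real.log n)) := by
      rw [← Real.sqrt_mul hn0.le, ← Real.sqrt_mul (by norm_num)]
      ring_nf
    have hc : 18 / 34 ≤ √(9 / 32 : ℝ) := Real.le_sqrt_of_sq_le (by norm_num)
    have hsn : 0 < √(n : ℝ) := Real.sqrt_pos.2 hn0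
    rw [e, ha, show (3 / 2 - 1 : ℝ) = 1 / 2 by norm_num, ← Real.sqrt_eq_rpow,
      div_le_div_iff₀ (by positivity) hs]
    have hpos : 0 < √(n : ℝ) * √(Real.log n) := by positivity
    nlinarith

end IsBifractionalBM

theorem mainTheorem1 (H K : ℝ) (hH0 : 0 < H) (hH1 : H < 1) (hK0 : 0 < K) (hK1 : K ≤ 1)
    (hHK : H * K ≤ 3 / 4) :
    ∃ c : ℝ, ∀ (Ω : Type*) [MeasurableSpace Ω] (P : Measure Ω) [IsProbabilityMeasure P]
      (B : ℝ≥0 → Ω → ℝ), IsBifractionalBM H K B P →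
      ∀ (Ω' : Type*) [MeasurableSpace Ω'] (Q : Measure Ω') [IsProbabilityMeasure Q]
        (N : Ω' → ℝ), HasLaw N (gaussianReal 0 1) Q →
        TendstoInDistribution (fun n : ℕ => normQuadVar H K B P n) atTop N (fun _ => P) Q ∧
        (H * K ≤ 1 / 2 → ∀ n : ℕ, 1 ≤ n →
          kolmogorovDist (normQuadVar H K B P n) P N Q ≤ c * (1 / √(n : ℝ))) ∧
        (1 / 2 ≤ H * K → H * K < 3 / 4 → ∀ n : ℕ, 1 ≤ n →
          kolmogorovDist (normQuadVar H K B P n) P N Q ≤ c * (n : ℝ) ^ (2 * H * K - 3 / 2)) ∧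
        (H * K = 3 / 4 → ∀ n : ℕ, 2 ≤ n →
          kolmogorovDist (normQuadVar H K B P n) P N Q ≤ c * (1 / √(Real.log (n : ℝ)))) := by
  refine ⟨34, fun Ω _ P _ B hB Ω' _ Q _ N hN => ?_⟩
  have h1 := fun h n hn =>
    hB.kolmogorovDist_le_of_mul_le_half hN hH0 hH1 hK0 hK1 h (n := n) hn
  have h2 := fun h n hn =>
    hB.kolmogorovDist_le_of_half_le_mul hN hH0 hH1 hK0 hK1 h hHK (n := n) hn
  have h3 := fun h n hn =>
    hB.kolmogorovDist_le_of_mul_eq hN hH0 hH1 hK0 hK1 h (n := n) hn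
  refine ⟨tendstoInDistribution_of_tendsto_kolmogorovDist (fun n => hB.aemeasurable_normQuadVar n)
    hN.aemeasurable ?_, h1, fun h _ => h2 h, h3⟩
  obtain ⟨r, hr, hle⟩ : ∃ r : ℕ → ℝ, Tendsto r atTop (nhds 0) ∧
      ∀ n, 2 ≤ n → kolmogorovDist (normQuadVar H K B P n) P N Q ≤ 34 * r n := by
    have hcast := tendsto_natCast_atTop_atTop (R := ℝ)
    rcases le_total (H * K) (1 / 2) with h | h
    · refine ⟨fun n => 1 / √(n : ℝ), ?_, fun n hn => h1 h n (by omega)⟩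
      simp_rw [one_div]
      exact (Real.tendsto_sqrt_atTop.comp hcast).inv_tendsto_atTop
    rcases lt_or_eq_of_le hHK with h' | h'
    · refine ⟨fun n => (n : ℝ) ^ (2 * H * K - 3 / 2), ?_, fun n hn => h2 h n (by omega)⟩
      have := (tendsto_rpow_neg_atTop (y := 3 / 2 - 2 * H * K) (by linarith)).comp hcast
      simpa [Function.comp_def] using this
    · refine ⟨fun n => 1 / √(Real.log n), ?_, h3 h'⟩
      simp_rw [one_div]
      exact (Real.tendsto_sqrt_atTop.comp (Real.tendsto_log_atTop.comp hcast)).inv_tendsto_atTop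
  have hr' := hr.const_mul 34
  rw [mul_zero] at hr'
  refine squeeze_zero' (Eventually.of_forall fun n => ?_) ?_ hr'
  · exact (abs_nonneg _).trans (abs_measureReal_sub_le_kolmogorovDist _ N 0)
  · filter_upwards [eventually_ge_atTop 2] with n hn using hle n hn
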